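/- For a finite simple graph $G$ and $g\in\{3,4,5,\dots\}\cup\{\infty\}$, let $\theta(g,G)$ (the $g$-girth-thickness of $G$) denote the smallest number of planar subgraphs of girth at least $g$ whose union is $G$, where the girth of a graph is the length of its shortest cycle, or $\infty$ if the graph is acyclic (and $\theta(g,G)=0$ if $G$ has no edges); thus $\theta(\infty,G)$ is the arboricity of $G$. Let $G\bowtie G$ denote the graph whose vertex set consists of two copies $u_1,\dots,u_n,v_1,\dots,v_n$ of the vertex set $\{w_1,\dots,w_n\}$ of $G$, and in which, for $x,y\in\{u,v\}$, the vertices $x_i$ and $y_j$ are adjacent if and only if $w_iw_j$ is an edge of $G$. If $G$ is a simple graph with $n\ge 2$ vertices and $e$ edges such that $\theta(\infty,G)=\left\lceil \frac{e}{n-1}\right\rceil$, then \[\theta(4,G\bowtie G)=\left\lceil \frac{e}{n-1}\right\rceil.\] -/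

import Mathlib

namespace SimpleGraph

/-- A planar embedding (plane drawing without crossings) of a simple graph: the vertices are
distinct points of the Euclidean plane, every edge is a simple arc joining the two points that
represent its ends, an arc passes through no vertex other than its ends, and two distinct arcs
meet only at common ends. -/
structure PlanarEmbedding {V : Type*} (G : SimpleGraph V) where
  /-- the point representing a vertex -/
  pos : V → EuclideanSpace ℝ (Fin 2)
  /-- the set of points of the arc representing an edge -/
  arc : G.edgeSet → Set (EuclideanSpace ℝ (Fin 2))
  pos_injective : Function.Injective pos
  arc_isArc : ∀ (u v : V) (h : G.Adj u v), ∃ γ : _root_.Path (pos u) (pos v),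
    Function.Injective γ ∧ Set.range γ = arc ⟨s(u, v), h⟩
  mem_of_pos_mem_arc : ∀ (w : V) (e : G.edgeSet), pos w ∈ arc e → w ∈ (e : Sym2 V)
  arc_inter_arc : ∀ e f : G.edgeSet, e ≠ f → ∀ x, x ∈ arc e → x ∈ arc f →
    ∃ w : V, w ∈ (e : Sym2 V) ∧ w ∈ (f : Sym2 V) ∧ x = pos w

/-- A graph is planar if it has a planar embedding. -/
def IsPlanar {V : Type*} (G : SimpleGraph V) : Prop :=
  Nonempty G.PlanarEmbedding

/-- `G` is the union of `k` planar subgraphs of girth at least `g`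
(an acyclic graph has girth `∞`). -/
def IsUnionOfPlanarOfGirth {V : Type*} (g : ℕ∞) (G : SimpleGraph V) (k : ℕ) : Prop :=
  ∃ H : Fin k → SimpleGraph V, (∀ i, (H i).IsPlanar ∧ g ≤ (H i).egirth) ∧ ⨆ i, H i = G

/-- The `g`-girth-thickness `θ(g, G)`: the smallest number of planar subgraphs of girth at least
`g` whose union is `G` (it would be `∞` if there were no such finite number). For `g = ∞` it is the
arboricity of `G`. -/
noncomputable def girthThickness {V : Type*} (g : ℕ∞) (G : SimpleGraph V) : ℕ∞ :=
  ⨅ (k : ℕ) (_ : IsUnionOfPlanarOfGirth g G k), (k : ℕ∞)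

/-- The graph `G ⋈ G`: its vertex set consists of two copies of the vertex set of `G`, and two
vertices are adjacent if and only if the vertices of `G` of which they are copies are adjacent. -/
def bowtie {V : Type*} (G : SimpleGraph V) : SimpleGraph (V ⊕ V) :=
  G.comap (Sum.elim id id)

end SimpleGraph

/-! Upper bound. A cover of `G` by forests `T` gives a cover of `G.bowtie` by the graphs `T.bowtie`.
A triangle of `T.bowtie` would project to a triangle of `T`, so there is none. For planarity the
larger graph `T.double` is drawn with straight segments. When a leaf `l` with neighbour `x` is
added, the segment between the two copies of `x` has an empty thin triangle beside it. Both copies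
of `l` fit there, forming with the copies of `x` a plane complete graph on four vertices
(`exists_isStraightDrawing_double_of_leaf`).

Lower bound. `G.bowtie` has `2n` vertices and `4e` edges, while a planar graph of girth at least
four on `2n` vertices has at most `2(2n) - 4 = 4(n-1)` edges (`IsPlanar.ncard_edgeSet_add_four_le`).
Hence `k` such graphs can cover it only if `e ≤ k(n-1)`.

That edge bound is derived from the topological definition of planarity by discretisation, with no
appeal to the Jordan curve theorem. On a fine grid, an embedding becomes a model of the graph as a
minor of the square grid (`PlanarEmbedding.exists_gridModel`). There the faces are classes of cells,
and every even finite set of grid edges is a cut of cells (`exists_cut`), so the face boundaries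
span the cycle space over `ZMod 2`. They sum to zero, each nonzero one has at least four edges, and
each edge lies on at most two; comparing dimensions gives the bound
(`card_edgeSet_add_four_le_of_faces`). -/

namespace SimpleGraph

/-! ### Cycle space over `ZMod 2` and the edge bound from faces. -/

section CycleSpace

variable {V : Type*} (G : SimpleGraph V) [Fintype G.edgeSet]

open scoped Classical in
/-- The boundary map over `ZMod 2` from sets of edges to sets of vertices. -/
noncomputable def boundary : (G.edgeSet → ZMod 2) →ₗ[ZMod 2] (V → ZMod 2) where
  toFun z v := ∑ e : G.edgeSet, if v ∈ (e : Sym2 V) then z e else 0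
  map_add' x y := by
    ext v
    simp only [Pi.add_apply, ← Finset.sum_add_distrib]
    exact Finset.sum_congr rfl fun e _ => by split_ifs <;> simp
  map_smul' c x := by
    ext v
    simp only [Pi.smul_apply, smul_eq_mul, RingHom.id_apply, Finset.mul_sum]
    exact Finset.sum_congr rfl fun e _ => by split_ifs <;> simp

/-- The cycle space over `ZMod 2`. -/
noncomputable def cycleSpace : Submodule (ZMod 2) (G.edgeSet → ZMod 2) :=
  LinearMap.ker G.boundary

open scoped Classical in
lemma boundary_apply (z : G.edgeSet → ZMod 2) (v : V) :
    G.boundary z v = ∑ e : G.edgeSet, if v ∈ (e : Sym2 V) then z e else 0 := rfl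

open scoped Classical in
lemma mem_cycleSpace (z : G.edgeSet → ZMod 2) :
    z ∈ G.cycleSpace ↔ ∀ v, (∑ e : G.edgeSet, if v ∈ (e : Sym2 V) then z e else 0) = 0 := by
  rw [cycleSpace, LinearMap.mem_ker, funext_iff]
  rfl

open scoped Classical in
lemma sum_boundary [Fintype V] (z : G.edgeSet → ZMod 2) : ∑ v, G.boundary z v = 0 := by
  simp only [boundary_apply]
  rw [Finset.sum_comm]
  refine Finset.sum_eq_zero fun e _ => ?_
  obtain ⟨⟨a, b⟩, h⟩ := e
  have hab : a ≠ b := G.ne_of_adj h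
  have : ∀ v, (if v ∈ (Sym2.mk a b : Sym2 V) then z ⟨Sym2.mk a b, h⟩ else 0)
      = (if v = a then z ⟨Sym2.mk a b, h⟩ else 0) + (if v = b then z ⟨Sym2.mk a b, h⟩ else 0) := by
    intro v
    by_cases h1 : v = a
    · subst h1; simp [hab]
    · simp [h1]
  refine (Finset.sum_congr rfl fun v _ => this v).trans ?_
  rw [Finset.sum_add_distrib]
  simp [CharTwo.add_self_eq_zero]

/-- Rank-nullity for `boundary`: its range lies in the hyperplane of vectors with sum zero, of
dimension one less than the number of vertices. Connectedness is not needed for this inequality. -/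
lemma card_edgeSet_le_finrank_cycleSpace [Fintype V] [Nonempty V] :
    Fintype.card G.edgeSet + 1 ≤ Module.finrank (ZMod 2) G.cycleSpace + Fintype.card V := by
  classical
  let φ : (V → ZMod 2) →ₗ[ZMod 2] ZMod 2 := ∑ v, LinearMap.proj v
  have hφ : ∀ x, φ x = ∑ v, x v := fun x => by simp [φ]
  have h1 := LinearMap.finrank_range_add_finrank_ker G.boundary
  have h2 := LinearMap.finrank_range_add_finrank_ker φ
  have h3 : Module.finrank (ZMod 2) (LinearMap.range G.boundary)
      ≤ Module.finrank (ZMod 2) (LinearMap.ker φ) := by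
    apply Submodule.finrank_mono
    rintro _ ⟨z, rfl⟩
    rw [LinearMap.mem_ker, hφ, sum_boundary]
  have h4 : LinearMap.range φ = ⊤ := by
    rw [LinearMap.range_eq_top]
    intro c
    obtain ⟨v⟩ := ‹Nonempty V›
    exact ⟨Pi.single v c, by rw [hφ]; simp⟩
  rw [h4, finrank_top] at h2
  simp only [Module.finrank_fintype_fun_eq_card, Module.finrank_self] at h1 h2
  change _ ≤ Module.finrank (ZMod 2) (LinearMap.ker G.boundary) + _
  omega

variable {G}

open scoped Classical in
-- An even set of edges cannot have degree one at `b`, so a walk in it can always be continued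
-- without turning back.
lemma exists_other_edge {z : G.edgeSet → ZMod 2} (hz : z ∈ G.cycleSpace) {a b : V}
    (h : G.Adj a b) (hne : z ⟨s(a, b), h⟩ ≠ 0) :
    ∃ c, ∃ h' : G.Adj b c, c ≠ a ∧ z ⟨s(b, c), h'⟩ ≠ 0 := by
  by_contra! hcon
  apply hne
  have := (G.mem_cycleSpace z).1 hz b
  rw [Finset.sum_eq_single ⟨s(a, b), h⟩] at this
  · simpa using this
  · rintro ⟨e, he⟩ _ hne'
    by_cases hb : b ∈ e
    · obtain ⟨c, rfl⟩ := Sym2.mem_iff_exists.1 hb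
      simp only [Sym2.mem_iff, true_or, if_true]
      refine hcon c he ?_
      rintro rfl
      exact hne' (Subtype.ext Sym2.eq_swap)
    · simp [hb]
  · simp

/-- A nonempty even set of edges of a triangle-free graph has at least four elements. -/
lemma four_le_card_support (htri : ∀ a b c, G.Adj a b → G.Adj b c → ¬ G.Adj c a)
    {z : G.edgeSet → ZMod 2} (hz : z ∈ G.cycleSpace) (hne : z ≠ 0) :
    4 ≤ (Finset.univ.filter fun e => z e ≠ 0).card := by
  classical
  obtain ⟨⟨⟨a, b⟩, hab⟩, h1⟩ := Function.ne_iff.1 hne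
  change G.Adj a b at hab
  -- The edge `ab` is extended twice beyond `b` and once beyond `a`. The only possible coincidence,
  -- `d = a`, would close a triangle; `y = d` is harmless, being the case of a 4-cycle.
  obtain ⟨c, hbc, hca, h2⟩ := exists_other_edge hz hab h1
  obtain ⟨d, hcd, hdb, h3⟩ := exists_other_edge hz hbc h2
  have h1' : z ⟨s(b, a), hab.symm⟩ ≠ 0 := by
    have : (⟨s(b, a), hab.symm⟩ : G.edgeSet) = ⟨s(a, b), hab⟩ := Subtype.ext Sym2.eq_swap
    rw [this]; exact h1
  obtain ⟨y, hay, hyb, h4⟩ := exists_other_edge hz hab.symm h1'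
  have hda : d ≠ a := by
    rintro rfl
    exact htri _ _ _ hab hbc hcd
  have hab' := hab.ne
  have hbc' := hbc.ne
  have hcd' := hcd.ne
  have hay' := hay.ne
  have hsub : ({⟨s(a, b), hab⟩, ⟨s(b, c), hbc⟩, ⟨s(c, d), hcd⟩, ⟨s(a, y), hay⟩} :
      Finset G.edgeSet) ⊆ Finset.univ.filter fun e => z e ≠ 0 := by
    intro e he
    simp only [Finset.mem_insert, Finset.mem_singleton] at he
    simp only [Finset.mem_filter, Finset.mem_univ, true_and]
    rcases he with rfl | rfl | rfl | rfl <;> assumption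
  refine le_trans (le_of_eq ?_) (Finset.card_le_card hsub)
  rw [Finset.card_insert_of_notMem, Finset.card_insert_of_notMem, Finset.card_insert_of_notMem,
    Finset.card_singleton]
  all_goals
    simp only [Finset.mem_insert, Finset.mem_singleton]
    grind

open scoped Classical in
/-- Two faces `l e`, `r e` are assigned to each edge `e`, the boundaries of the faces are in the
cycle space, and they span it. -/
theorem card_edgeSet_add_four_le_of_faces [Fintype V] [Nonempty V] (hV : 3 ≤ Fintype.card V)
    (htri : ∀ a b c, G.Adj a b → G.Adj b c → ¬ G.Adj c a) {F : Type*} (l r : G.edgeSet → F)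
    (hbd : ∀ f, (fun e => (if l e = f then 1 else 0) + if r e = f then 1 else 0) ∈ G.cycleSpace)
    (hspan : ∀ z ∈ G.cycleSpace, ∃ w : F → ZMod 2, ∀ e, z e = w (l e) + w (r e)) :
    Fintype.card G.edgeSet + 4 ≤ 2 * Fintype.card V := by
  set ζ : F → G.edgeSet → ZMod 2 :=
    fun f e => (if l e = f then 1 else 0) + if r e = f then 1 else 0 with hζ
  -- Only faces with nonzero boundary are kept: they are finitely many, and each has at least four
  -- boundary edges.
  set Φ : Finset F := (Finset.univ.image l ∪ Finset.univ.image r).filter fun f => ζ f ≠ 0 with hΦ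
  have key : ∀ w : F → ZMod 2, ∀ e, ∑ f ∈ Φ, w f * ζ f e = w (l e) + w (r e) := by
    intro w e
    have hl : l e ∈ Finset.univ.image l ∪ Finset.univ.image r := by simp
    have hr : r e ∈ Finset.univ.image l ∪ Finset.univ.image r := by simp
    rw [hΦ, Finset.sum_filter_of_ne]
    · simp only [hζ, mul_add, Finset.sum_add_distrib, mul_ite, mul_one, mul_zero]
      rw [Finset.sum_ite_eq, Finset.sum_ite_eq, if_pos hl, if_pos hr]
    · rintro f - h h0
      rw [h0] at h
      simp at h
  have hspan' : G.cycleSpace ≤ Submodule.span (ZMod 2) (Φ.image ζ : Set _) := by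
    intro z hz
    obtain ⟨w, hw⟩ := hspan z hz
    have : z = ∑ f ∈ Φ, w f • ζ f := by
      ext e
      rw [hw, ← key w e, Finset.sum_apply]
      rfl
    rw [this]
    exact Submodule.sum_mem _ fun f hf => Submodule.smul_mem _ _
      (Submodule.subset_span (Finset.mem_coe.2 (Finset.mem_image_of_mem _ hf)))
  have h1 := G.card_edgeSet_le_finrank_cycleSpace
  -- Double counting of pairs of a face and an edge on its boundary.
  have hcount : 4 * Φ.card ≤ 2 * Fintype.card G.edgeSet := by
    calc 4 * Φ.card = ∑ f ∈ Φ, 4 := by simp [mul_comm]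
      _ ≤ ∑ f ∈ Φ, (Finset.univ.filter fun e => ζ f e ≠ 0).card :=
        Finset.sum_le_sum fun f hf =>
          four_le_card_support htri (hbd f) (Finset.mem_filter.1 hf).2
      _ = ∑ e, (Φ.filter fun f => ζ f e ≠ 0).card := by
        simp only [Finset.card_filter]
        exact Finset.sum_comm
      _ ≤ ∑ e : G.edgeSet, 2 := by
        refine Finset.sum_le_sum fun e _ => ?_
        refine (Finset.card_le_card (t := {l e, r e}) fun f hf => ?_).trans Finset.card_le_two
        have := (Finset.mem_filter.1 hf).2
        simp only [hζ] at this
        by_contra hn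
        simp only [Finset.mem_insert, Finset.mem_singleton, not_or] at hn
        rw [if_neg (Ne.symm hn.1), if_neg (Ne.symm hn.2)] at this
        simp at this
      _ = 2 * Fintype.card G.edgeSet := by simp [mul_comm]
  -- With no such face the cycle space is zero and there are fewer edges than vertices; `3 ≤ n` then
  -- suffices.
  rcases Φ.eq_empty_or_nonempty with h0 | ⟨f₀, hf₀⟩
  · have h2 := Submodule.finrank_mono hspan'
    rw [h0, Finset.image_empty, Finset.coe_empty, Submodule.span_empty, finrank_bot] at h2
    omega
  -- Every edge has two sides, so the boundaries sum to zero and `f₀` is redundant. This saves one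
  -- dimension, as the sharp constant requires.
  · have hsum : ∑ f ∈ Φ, ζ f = 0 := by
      ext e
      have := key 1 e
      simp only [Pi.one_apply, one_mul] at this
      rw [Finset.sum_apply, this]
      rfl
    have hle : Submodule.span (ZMod 2) (Φ.image ζ : Set (G.edgeSet → ZMod 2))
        ≤ Submodule.span (ZMod 2) (((Φ.erase f₀).image ζ : Finset _) : Set _) := by
      rw [Submodule.span_le]
      intro x hx
      obtain ⟨f, hf, rfl⟩ := Finset.mem_image.1 (Finset.mem_coe.1 hx)
      by_cases hff : f = f₀
      · subst hff
        rw [← Finset.add_sum_erase _ _ hf] at hsum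
        rw [eq_neg_of_add_eq_zero_left hsum]
        exact Submodule.neg_mem _ (Submodule.sum_mem _ fun g hg =>
          Submodule.subset_span (Finset.mem_coe.2 (Finset.mem_image_of_mem _ hg)))
      · exact Submodule.subset_span (Finset.mem_coe.2
          (Finset.mem_image_of_mem _ (Finset.mem_erase.2 ⟨hff, hf⟩)))
    have h2 := Submodule.finrank_mono (hspan'.trans hle)
    have h3 := finrank_span_finset_le_card (R := ZMod 2) ((Φ.erase f₀).image ζ)
    have h4 := Finset.card_image_le (s := Φ.erase f₀) (f := ζ)
    have h5 := Finset.card_erase_add_one hf₀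
    simp only [Set.finrank] at h3
    omega

end CycleSpace

end SimpleGraph

/-! ### The square grid -/

namespace SquareGrid

/-- `(false, p)` is the unit edge going right from `p`, and `(true, p)` the one going up.
This is the start of an edge. -/
def src (a : Bool × ℤ × ℤ) : ℤ × ℤ := a.2

/-- The end of an edge. -/
def tgt : Bool × ℤ × ℤ → ℤ × ℤ
  | (false, i, j) => (i + 1, j)
  | (true, i, j) => (i, j + 1)

/-- The cell on one side of an edge; `(i, j)` is the cell whose lower left corner is `(i, j)`. -/
def cellPos (a : Bool × ℤ × ℤ) : ℤ × ℤ := a.2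

/-- The cell on the other side of an edge. -/
def cellNeg : Bool × ℤ × ℤ → ℤ × ℤ
  | (false, i, j) => (i, j - 1)
  | (true, i, j) => (i - 1, j)

/-- The coefficient of a point in the boundary of an edge. -/
def inc (a : Bool × ℤ × ℤ) (p : ℤ × ℤ) : ZMod 2 :=
  (if src a = p then 1 else 0) + if tgt a = p then 1 else 0

/-- Adjacency of grid points. -/
def Adj (p q : ℤ × ℤ) : Prop :=
  ∃ a, (src a = p ∧ tgt a = q) ∨ (src a = q ∧ tgt a = p)

lemma Adj.symm {p q : ℤ × ℤ} : Adj p q → Adj q p := fun ⟨a, h⟩ => ⟨a, h.symm⟩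

lemma adj_right (i j : ℤ) : Adj (i, j) (i + 1, j) := ⟨(false, i, j), Or.inl ⟨rfl, rfl⟩⟩

lemma adj_up (i j : ℤ) : Adj (i, j) (i, j + 1) := ⟨(true, i, j), Or.inl ⟨rfl, rfl⟩⟩

/-- The edges at a point. -/
def star (p : ℤ × ℤ) : Finset (Bool × ℤ × ℤ) :=
  {(false, p.1, p.2), (false, p.1 - 1, p.2), (true, p.1, p.2), (true, p.1, p.2 - 1)}

lemma inc_eq_zero {a : Bool × ℤ × ℤ} {p : ℤ × ℤ} (h : a ∉ star p) : inc a p = 0 := by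
  obtain ⟨b, i, j⟩ := a
  obtain ⟨k, l⟩ := p
  simp only [star, Finset.mem_insert, Finset.mem_singleton, not_or, Prod.mk.injEq] at h
  have h1 : ¬ (src (b, i, j) = (k, l)) := by
    simp only [src, Prod.mk.injEq]
    cases b <;> simp_all
  have h2 : ¬ (tgt (b, i, j) = (k, l)) := by
    cases b <;> simp only [tgt, Prod.mk.injEq] <;> rintro ⟨rfl, rfl⟩ <;> simp_all
  rw [inc, if_neg h1, if_neg h2, add_zero]

lemma sum_star (p : ℤ × ℤ) (x : Bool × ℤ × ℤ → ZMod 2) :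
    ∑ a ∈ star p, x a * inc a p = x (false, p.1, p.2) + x (false, p.1 - 1, p.2)
      + x (true, p.1, p.2) + x (true, p.1, p.2 - 1) := by
  obtain ⟨i, j⟩ := p
  rw [star, Finset.sum_insert, Finset.sum_insert, Finset.sum_insert, Finset.sum_singleton]
  · simp [inc, src, tgt, add_assoc]
  all_goals simp <;> omega

lemma sum_mul_inc (H : Finset (Bool × ℤ × ℤ)) (x : Bool × ℤ × ℤ → ZMod 2)
    (hx : ∀ a ∉ H, x a = 0) (p : ℤ × ℤ) :
    ∑ a ∈ H, x a * inc a p = x (false, p.1, p.2) + x (false, p.1 - 1, p.2)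
      + x (true, p.1, p.2) + x (true, p.1, p.2 - 1) := by
  rw [← sum_star]
  trans ∑ a ∈ H ∪ star p, x a * inc a p
  · refine Finset.sum_subset Finset.subset_union_left fun a _ ha => ?_
    rw [hx a ha, zero_mul]
  · symm
    refine Finset.sum_subset Finset.subset_union_right fun a _ ha => ?_
    rw [inc_eq_zero ha, mul_zero]

/-- A cut of the set of cells has even degree at every point. -/
lemma sum_cut_mul_inc (H : Finset (Bool × ℤ × ℤ)) (w : ℤ × ℤ → ZMod 2)
    (hw : ∀ a ∉ H, w (cellPos a) = w (cellNeg a)) (p : ℤ × ℤ) :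
    ∑ a ∈ H, (w (cellPos a) + w (cellNeg a)) * inc a p = 0 := by
  rw [sum_mul_inc H (fun a => w (cellPos a) + w (cellNeg a))
    fun a ha => by rw [hw a ha, CharTwo.add_self_eq_zero]]
  simp only [cellPos, cellNeg]
  -- Each of the four cells around the point borders two of the four edges there, so its value
  -- occurs twice.
  generalize w (p.1, p.2) = a, w (p.1, p.2 - 1) = b, w (p.1 - 1, p.2) = c,
    w (p.1 - 1, p.2 - 1) = d
  revert a b c d
  decide

/-- Every even finite set of edges is a cut of the set of cells. -/
lemma exists_cut (H : Finset (Bool × ℤ × ℤ)) (x : Bool × ℤ × ℤ → ZMod 2)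
    (hx : ∀ a ∉ H, x a = 0) (hev : ∀ p, ∑ a ∈ H, x a * inc a p = 0) :
    ∃ w : ℤ × ℤ → ZMod 2, ∀ a, x a = w (cellPos a) + w (cellNeg a) := by
  obtain ⟨M, hM⟩ : ∃ M : ℤ, ∀ a ∈ H, M ≤ a.2.1 := by
    obtain ⟨M, hM⟩ := (H.image fun a => a.2.1).bddBelow
    exact ⟨M, fun a ha => hM (Finset.mem_coe.2 (Finset.mem_image_of_mem _ ha))⟩
  have hx0 : ∀ b i j, i < M → x (b, i, j) = 0 := fun b i j hi => by
    refine hx _ fun h => ?_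
    have := hM _ h
    simp only at this
    omega
  -- The value at a cell is the parity of the vertical edges crossed by the horizontal ray going
  -- left; nothing lies left of `M`.
  let w : ℤ × ℤ → ZMod 2 := fun c => ∑ k ∈ Finset.Icc M c.1, x (true, k, c.2)
  have hv : ∀ i j, w (i, j) = x (true, i, j) + w (i - 1, j) := by
    intro i j
    simp only [w]
    by_cases hi : M ≤ i
    · have : Finset.Icc M i = insert i (Finset.Icc M (i - 1)) := by
        ext k; simp only [Finset.mem_Icc, Finset.mem_insert]; omega
      rw [this, Finset.sum_insert (by simp)]
    · rw [Finset.Icc_eq_empty (by omega), Finset.Icc_eq_empty (by omega), hx0 _ _ _ (by omega)]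
      simp
  have hsmall : ∀ i j, i < M → w (i, j) = 0 := fun i j hi => by
    simp only [w]
    rw [Finset.Icc_eq_empty (by omega), Finset.sum_empty]
  -- Vertical edges satisfy the claim by construction. For horizontal edges it spreads from the
  -- empty region on the left, evenness at `(i + 1, j)` giving the induction step.
  have hh : ∀ j i, M - 1 ≤ i → x (false, i, j) = w (i, j) + w (i, j - 1) := by
    intro j i hi
    induction i, hi using Int.leInduction with
    | base => rw [hx0 _ _ _ (by omega), hsmall _ _ (by omega), hsmall _ _ (by omega), add_zero]
    | succ i hi ih =>
      have h1 := hev (i + 1, j)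
      rw [sum_mul_inc H x hx] at h1
      have h2 := hv (i + 1) j
      have h3 := hv (i + 1) (j - 1)
      simp only [add_sub_cancel_right] at h1 h2 h3
      rw [h2, h3]
      rw [ih] at h1
      revert h1
      generalize x (false, i + 1, j) = a, w (i, j) = b, w (i, j - 1) = c,
        x (true, i + 1, j) = d, x (true, i + 1, j - 1) = e
      revert a b c d e
      decide
  refine ⟨w, ?_⟩
  rintro ⟨b, i, j⟩
  cases b
  · simp only [cellPos, cellNeg]
    by_cases hi : M - 1 ≤ i
    · exact hh j i hi
    · rw [hx0 _ _ _ (by omega), hsmall _ _ (by omega), hsmall _ _ (by omega), add_zero]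
  · simp only [cellPos, cellNeg]
    rw [hv i j, add_assoc, CharTwo.add_self_eq_zero, add_zero]

/-- Two points connected by edges in `S` are the boundary of a set of edges in `S`. -/
lemma exists_chain_of_reflTransGen (H : Finset (Bool × ℤ × ℤ)) (S : Set (Bool × ℤ × ℤ))
    (hS : S ⊆ H) {p q : ℤ × ℤ}
    (h : Relation.ReflTransGen
      (fun p q => ∃ a ∈ S, (src a = p ∧ tgt a = q) ∨ (src a = q ∧ tgt a = p)) p q) :
    ∃ x : Bool × ℤ × ℤ → ZMod 2, (∀ a ∉ S, x a = 0) ∧ ∀ r, ∑ a ∈ H, x a * inc a r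
      = (if p = r then 1 else 0) + if q = r then 1 else 0 := by
  induction h with
  | refl => exact ⟨0, by simp, by simp [CharTwo.add_self_eq_zero]⟩
  | tail _ hbc ih =>
    obtain ⟨x, hx, hxs⟩ := ih
    obtain ⟨a, ha, hac⟩ := hbc
    refine ⟨x + Pi.single a 1, fun b hb => ?_, fun r => ?_⟩
    · rw [Pi.add_apply, hx b hb, Pi.single_eq_of_ne (by rintro rfl; exact hb ha), add_zero]
    · simp only [Pi.add_apply, add_mul, Finset.sum_add_distrib, hxs]
      rw [Finset.sum_eq_single_of_mem a (hS ha)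
        (fun b _ hb => by rw [Pi.single_eq_of_ne hb, zero_mul]), Pi.single_eq_same, one_mul, inc]
      rcases hac with ⟨rfl, rfl⟩ | ⟨rfl, rfl⟩ <;>
      · generalize (if _ = r then (1 : ZMod 2) else 0) = A, (if _ = r then (1 : ZMod 2) else 0) = B,
          (if _ = r then (1 : ZMod 2) else 0) = C
        revert A B C
        decide

end SquareGrid

/-! ### The edge bound for triangle-free minors of the square grid. -/

namespace SimpleGraph

open SquareGrid

/-- A model of `G` as a minor of the square grid: `L p` is the vertex whose branch set contains
the point `p`. -/
structure GridModel {V : Type*} (G : SimpleGraph V) (L : ℤ × ℤ → Option V) : Prop where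
  finite : {p | L p ≠ none}.Finite
  connected : ∀ v p q, L p = some v → L q = some v →
    Relation.ReflTransGen (fun p q => SquareGrid.Adj p q ∧ L p = some v ∧ L q = some v) p q
  exists_adj : ∀ u v, G.Adj u v → ∃ p q, SquareGrid.Adj p q ∧ L p = some u ∧ L q = some v

open scoped Classical in
/-- A triangle-free minor of the square grid on `n ≥ 3` vertices has at most `2 n - 4` edges. -/
theorem GridModel.card_edgeSet_add_four_le {V : Type*} [Fintype V] {G : SimpleGraph V}
    [Fintype G.edgeSet] {L : ℤ × ℤ → Option V} (hL : G.GridModel L) (hV : 3 ≤ Fintype.card V)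
    (htri : ∀ a b c, G.Adj a b → G.Adj b c → ¬ G.Adj c a) :
    Fintype.card G.edgeSet + 4 ≤ 2 * Fintype.card V := by
  have : Nonempty V := Fintype.card_pos_iff.1 (by omega)
  have hg : ∀ e : G.edgeSet, ∃ a : Bool × ℤ × ℤ, ∃ u v, L (src a) = some u ∧ L (tgt a) = some v ∧
      u ≠ v ∧ (e : Sym2 V) = s(u, v) := by
    rintro ⟨⟨u, v⟩, h⟩
    change G.Adj u v at h
    obtain ⟨p, q, ⟨a, ⟨rfl, rfl⟩ | ⟨rfl, rfl⟩⟩, hp, hq⟩ := hL.exists_adj u v h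
    · exact ⟨a, u, v, hp, hq, h.ne, rfl⟩
    · exact ⟨a, v, u, hq, hp, h.ne', Sym2.eq_swap⟩
  choose g gu gv hgu hgv hguv hge using hg
  have hginj : Function.Injective g := by
    intro e e' h
    have h1 := hgu e
    have h2 := hgv e
    rw [h, hgu] at h1
    rw [h, hgv] at h2
    apply Subtype.ext
    rw [hge e, hge e', Option.some.inj h1, Option.some.inj h2]
  -- `S` consists of the grid edges inside branch sets. With one chosen grid edge `g e` for each
  -- edge of `G` it forms `H`, and contracting `S` in `H` gives `G`.
  set S : Set (Bool × ℤ × ℤ) := {a | ∃ v, L (src a) = some v ∧ L (tgt a) = some v} with hS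
  have hSfin : S.Finite := by
    refine (Set.finite_univ.prod hL.finite).subset ?_
    rintro ⟨b, p⟩ ⟨v, h, -⟩
    refine ⟨Set.mem_univ _, ?_⟩
    change L p = some v at h
    simp [h]
  have hgS : ∀ e, g e ∉ S := by
    rintro e ⟨v, h1, h2⟩
    rw [hgu] at h1
    rw [hgv] at h2
    exact hguv e (Option.some.inj (h1.trans h2.symm))
  set H : Finset (Bool × ℤ × ℤ) := hSfin.toFinset ∪ Finset.univ.image g with hH
  have hSH : S ⊆ H := fun a ha => by simp [hH, ha]
  have hgH : ∀ e, g e ∈ H := fun e => by simp [hH]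
  set P : Finset (ℤ × ℤ) := hL.finite.toFinset with hP
  have hmemP : ∀ p, p ∈ P ↔ L p ≠ none := fun p => by simp [hP]
  have hsuminc : ∀ v a, ∑ p ∈ P.filter (fun p => L p = some v), inc a p
      = (if L (src a) = some v then 1 else 0) + if L (tgt a) = some v then 1 else 0 := by
    intro v a
    simp only [inc, Finset.sum_add_distrib, Finset.sum_ite_eq, Finset.mem_filter, hmemP]
    congr 1 <;> refine if_congr ?_ rfl rfl <;> exact ⟨fun h => h.2, fun h => ⟨by simp [h], h⟩⟩
  have hinc : ∀ v e, ((if L (src (g e)) = some v then 1 else 0)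
      + if L (tgt (g e)) = some v then 1 else 0 : ZMod 2) = if v ∈ (e : Sym2 V) then 1 else 0 := by
    intro v e
    rw [hgu, hgv, hge]
    have := hguv e
    by_cases h1 : gu e = v
    · subst h1; simp [this.symm]
    · simp [Ne.symm h1, eq_comm]
  -- Summed over a branch set, the boundary of a set of grid edges loses its part in `S` and becomes
  -- a boundary in `G`.
  have hsumH : ∀ (v) (x : Bool × ℤ × ℤ → ZMod 2),
      ∑ p ∈ P.filter (fun p => L p = some v), ∑ a ∈ H, x a * inc a p
        = ∑ e : G.edgeSet, if v ∈ (e : Sym2 V) then x (g e) else 0 := by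
    intro v x
    rw [Finset.sum_comm]
    simp only [← Finset.mul_sum, hsuminc]
    rw [← Finset.sum_subset (s₁ := Finset.univ.image g) (by simp [hH]), Finset.sum_image
      (fun _ _ _ _ h => hginj h)]
    · refine Finset.sum_congr rfl fun e _ => ?_
      rw [hinc]
      simp
    · intro a ha hna
      have haS : a ∈ S := by
        rw [hH, Finset.mem_union] at ha
        simpa using ha.resolve_right hna
      obtain ⟨u, h1, h2⟩ := haS
      rw [h1, h2, CharTwo.add_self_eq_zero, mul_zero]
  -- Cells separated by an edge outside `H` are identified, so the classes are the faces of `H`.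
  let R : ℤ × ℤ → ℤ × ℤ → Prop := fun c c' => ∃ a, a ∉ H ∧ cellPos a = c ∧ cellNeg a = c'
  refine card_edgeSet_add_four_le_of_faces hV htri (F := Quot R)
    (fun e => Quot.mk R (cellPos (g e))) (fun e => Quot.mk R (cellNeg (g e))) ?_ ?_
  · intro f
    rw [mem_cycleSpace]
    intro v
    set w : ℤ × ℤ → ZMod 2 := fun c => if Quot.mk R c = f then 1 else 0 with hw
    rw [← hsumH v fun a => w (cellPos a) + w (cellNeg a)]
    refine Finset.sum_eq_zero fun p _ => sum_cut_mul_inc H w (fun a ha => ?_) p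
    have : Quot.mk R (cellPos a) = Quot.mk R (cellNeg a) := Quot.sound ⟨a, ha, rfl, rfl⟩
    simp only [hw, this]
  · intro z hz
    rw [mem_cycleSpace] at hz
    -- A cycle `z` of `G` is lifted to an even set in `H`. The chosen edges have boundary `t`, whose
    -- sum over each branch set is zero, so it can be cancelled by edges of `S`: each point is
    -- joined to the base point `β` of its branch set.
    set t : ℤ × ℤ → ZMod 2 := fun p => ∑ e, z e * inc (g e) p with ht
    have htP : ∀ p, p ∉ P → t p = 0 := by
      intro p hp
      refine Finset.sum_eq_zero fun e _ => ?_
      have h1 : src (g e) ≠ p := by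
        rintro rfl; exact hp ((hmemP _).2 (by simp [hgu]))
      have h2 : tgt (g e) ≠ p := by
        rintro rfl; exact hp ((hmemP _).2 (by simp [hgv]))
      rw [inc, if_neg h1, if_neg h2, add_zero, mul_zero]
    have htv : ∀ v, ∑ p ∈ P.filter (fun p => L p = some v), t p = 0 := by
      intro v
      rw [← hz v, Finset.sum_comm]
      refine Finset.sum_congr rfl fun e _ => ?_
      rw [← Finset.mul_sum, hsuminc, hinc]
      simp
    obtain ⟨β, hβ⟩ : ∃ β : Option V → ℤ × ℤ, ∀ p, L (β (L p)) = L p :=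
      ⟨Function.invFun L, fun p => Function.invFun_eq ⟨p, rfl⟩⟩
    have hchain : ∀ p, ∃ x : Bool × ℤ × ℤ → ZMod 2, p ∈ P → (∀ a ∉ S, x a = 0) ∧
        ∀ r, ∑ a ∈ H, x a * inc a r
          = (if p = r then 1 else 0) + if β (L p) = r then 1 else 0 := by
      intro p
      by_cases hp : p ∈ P
      · obtain ⟨v, hv⟩ := Option.ne_none_iff_exists'.1 ((hmemP p).1 hp)
        obtain ⟨x, hx⟩ := exists_chain_of_reflTransGen H S hSH (p := p) (q := β (L p)) <| by
          refine Relation.ReflTransGen.mono ?_ _ _ (hL.connected v p _ hv ((hβ p).trans hv))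
          rintro a b ⟨⟨c, ⟨rfl, rfl⟩ | ⟨rfl, rfl⟩⟩, h1, h2⟩
          · exact ⟨c, ⟨v, h1, h2⟩, Or.inl ⟨rfl, rfl⟩⟩
          · exact ⟨c, ⟨v, h2, h1⟩, Or.inr ⟨rfl, rfl⟩⟩
        exact ⟨x, fun _ => hx⟩
      · exact ⟨0, fun h => absurd h hp⟩
    choose x hx using hchain
    set X : Bool × ℤ × ℤ → ZMod 2 := fun a => ∑ p ∈ P, t p * x p a with hX
    have hXS : ∀ a ∉ S, X a = 0 := fun a ha =>
      Finset.sum_eq_zero fun p hp => by rw [(hx p hp).1 a ha, mul_zero]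
    have hXb : ∀ r, ∑ a ∈ H, X a * inc a r = t r := by
      intro r
      simp only [hX, Finset.sum_mul]
      rw [Finset.sum_comm]
      have : ∀ p ∈ P, ∑ a ∈ H, t p * x p a * inc a r
          = (if p = r then t p else 0) + if β (L p) = r then t p else 0 := by
        intro p hp
        simp only [mul_assoc, ← Finset.mul_sum]
        rw [(hx p hp).2 r, mul_add, mul_ite, mul_ite, mul_one, mul_zero]
      rw [Finset.sum_congr rfl this, Finset.sum_add_distrib, Finset.sum_ite_eq']
      have h0 : ∑ p ∈ P, (if β (L p) = r then t p else 0) = 0 := by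
        rw [← Finset.sum_filter]
        by_cases hr : β (L r) = r ∧ r ∈ P
        · obtain ⟨v, hv⟩ := Option.ne_none_iff_exists'.1 ((hmemP r).1 hr.2)
          rw [← htv v]
          refine Finset.sum_congr (Finset.filter_congr fun p _ => ?_) fun _ _ => rfl
          rw [← hv]
          constructor
          · intro h; rw [← hβ p, h]
          · intro h; rw [h, hr.1]
        · rw [Finset.filter_false_of_mem, Finset.sum_empty]
          rintro p hp rfl
          refine hr ⟨by rw [hβ], ?_⟩
          rw [hmemP] at hp ⊢
          rwa [hβ]
      rw [h0, add_zero]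
      split_ifs with h
      · rfl
      · exact (htP r h).symm
    set y : Bool × ℤ × ℤ → ZMod 2 := fun a => X a + ∑ e, if g e = a then z e else 0 with hy
    have hyH : ∀ a ∉ H, y a = 0 := by
      intro a ha
      simp only [hy]
      rw [hXS a fun h => ha (hSH h), zero_add]
      refine Finset.sum_eq_zero fun e _ => if_neg ?_
      rintro rfl
      exact ha (hgH e)
    have hyev : ∀ p, ∑ a ∈ H, y a * inc a p = 0 := by
      intro p
      simp only [hy, add_mul, Finset.sum_add_distrib, hXb, Finset.sum_mul]
      rw [Finset.sum_comm]
      have : ∀ e, ∑ a ∈ H, (if g e = a then z e else 0) * inc a p = z e * inc (g e) p := by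
        intro e
        simp only [ite_mul, zero_mul]
        rw [Finset.sum_ite_eq, if_pos (hgH e)]
      simp only [this]
      exact CharTwo.add_self_eq_zero _
    obtain ⟨w, hw⟩ := exists_cut H y hyH hyev
    -- The lift `y` vanishes outside `H`, so the cell function cutting it out is constant on faces.
    refine ⟨Quot.lift w ?_, fun e => ?_⟩
    · rintro _ _ ⟨a, ha, rfl, rfl⟩
      have := hw a
      rw [hyH a ha] at this
      exact CharTwo.add_eq_zero.1 this.symm
    · change z e = w _ + w _
      rw [← hw, hy]
      simp only [hXS _ (hgS e), zero_add, hginj.eq_iff, Finset.sum_ite_eq', Finset.mem_univ,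
        if_true]

end SimpleGraph

/-! ### Grid models from connected sets of grid points. -/

namespace SquareGrid

/-- Connectedness of a set of grid points. -/
def Connected (B : Set (ℤ × ℤ)) : Prop :=
  ∀ p ∈ B, ∀ q ∈ B, Relation.ReflTransGen (fun p q => Adj p q ∧ p ∈ B ∧ q ∈ B) p q

lemma reflTransGen_symm {B : Set (ℤ × ℤ)} {p q : ℤ × ℤ}
    (h : Relation.ReflTransGen (fun p q => Adj p q ∧ p ∈ B ∧ q ∈ B) p q) :
    Relation.ReflTransGen (fun p q => Adj p q ∧ p ∈ B ∧ q ∈ B) q p := by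
  induction h with
  | refl => exact .refl
  | tail _ h ih => exact Relation.ReflTransGen.head ⟨h.1.symm, h.2.2, h.2.1⟩ ih

lemma reflTransGen_mono {B C : Set (ℤ × ℤ)} (hBC : B ⊆ C) {p q : ℤ × ℤ}
    (h : Relation.ReflTransGen (fun p q => Adj p q ∧ p ∈ B ∧ q ∈ B) p q) :
    Relation.ReflTransGen (fun p q => Adj p q ∧ p ∈ C ∧ q ∈ C) p q :=
  Relation.ReflTransGen.mono (fun _ _ h => ⟨h.1, hBC h.2.1, hBC h.2.2⟩) _ _ h

end SquareGrid

namespace SimpleGraph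

open SquareGrid

/-- Disjoint connected sets of grid points for the vertices of `G`, joined by disjoint connected
sets of grid points for the edges, give a model of `G` as a minor of the grid. -/
theorem exists_gridModel {V : Type*} [Finite V] {G : SimpleGraph V} (s t : G.edgeSet → V)
    (hst : ∀ e : G.edgeSet, (e : Sym2 V) = s(s e, t e))
    (K : V → Set (ℤ × ℤ)) (M : G.edgeSet → Set (ℤ × ℤ))
    (hKfin : ∀ v, (K v).Finite) (hKconn : ∀ v, SquareGrid.Connected (K v))
    (hKdisj : ∀ v w, v ≠ w → Disjoint (K v) (K w))
    (hMfin : ∀ e, (M e).Finite) (hMconn : ∀ e, SquareGrid.Connected (M e))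
    (hMdisj : ∀ e f, e ≠ f → Disjoint (M e) (M f))
    (hMK : ∀ (e : G.edgeSet) w, w ∉ (e : Sym2 V) → Disjoint (M e) (K w))
    (hs : ∀ e, (M e ∩ K (s e)).Nonempty) (ht : ∀ e, (M e ∩ K (t e)).Nonempty) :
    ∃ L, G.GridModel L := by
  classical
  have hne : ∀ e, s e ≠ t e := fun e h => by
    have := e.2
    rw [hst, h] at this
    exact G.loopless.irrefl _ this
  -- `T e` is the part of `M e` reachable from `K (s e)` without entering `K (t e)`. It is absorbed
  -- into the branch set of `s e`, which makes the branch sets disjoint and adjacent.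
  let N : G.edgeSet → Set (ℤ × ℤ) := fun e => M e \ K (t e)
  let T : G.edgeSet → Set (ℤ × ℤ) := fun e => {x | ∃ p ∈ K (s e), p ∈ M e ∧
    Relation.ReflTransGen (fun p q => SquareGrid.Adj p q ∧ p ∈ N e ∧ q ∈ N e) p x}
  have hTN : ∀ e, T e ⊆ N e := by
    rintro e x ⟨p, hp, hpM, h⟩
    induction h with
    | refl => exact ⟨hpM, Set.disjoint_left.1 (hKdisj _ _ (hne e)) hp⟩
    | tail _ h _ => exact h.2.2
  have hTM : ∀ e, T e ⊆ M e := fun e x hx => (hTN e hx).1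
  have hTK : ∀ e v, v ≠ s e → Disjoint (T e) (K v) := by
    intro e v hv
    by_cases h : v = t e
    · subst h
      exact Set.disjoint_left.2 fun x hx => (hTN e hx).2
    · exact (hMK e v (by rw [hst]; simp [hv, h])).mono_left (hTM e)
  have hTadj : ∀ e, ∃ a ∈ T e, ∃ b ∈ K (t e), SquareGrid.Adj a b := by
    intro e
    obtain ⟨p, hpM, hpK⟩ := hs e
    obtain ⟨q, hqM, hqK⟩ := ht e
    -- Along a path in `M e` towards `K (t e)`, the last point before that set is first entered lies
    -- in `T e`.
    have key : ∀ x, Relation.ReflTransGen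
        (fun p q => SquareGrid.Adj p q ∧ p ∈ M e ∧ q ∈ M e) p x →
        x ∈ T e ∨ ∃ a ∈ T e, ∃ b ∈ K (t e), SquareGrid.Adj a b := by
      intro x h
      induction h with
      | refl => exact Or.inl ⟨p, hpK, hpM, .refl⟩
      | @tail x y _ hxy ih =>
        refine or_iff_not_imp_right.2 fun hn => ?_
        have hx := ih.resolve_right hn
        have hy : y ∉ K (t e) := fun hy => hn ⟨x, hx, y, hy, hxy.1⟩
        obtain ⟨p', h1, h2, h3⟩ := hx
        exact ⟨p', h1, h2, h3.tail ⟨hxy.1, hTN e ⟨p', h1, h2, h3⟩, hxy.2.2, hy⟩⟩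
    refine (key q (hMconn e p hpM q hqM)).resolve_left fun h => (hTN e h).2 hqK
  let B : V → Set (ℤ × ℤ) := fun v => K v ∪ ⋃ (e : G.edgeSet) (_ : s e = v), T e
  have hTB : ∀ e, T e ⊆ B (s e) := fun e x hx =>
    Or.inr (by simp only [Set.mem_iUnion]; exact ⟨e, rfl, hx⟩)
  have hBdisj : ∀ v w x, x ∈ B v → x ∈ B w → v = w := by
    rintro v w x (hv | hv) (hw | hw)
    · by_contra h
      exact Set.disjoint_left.1 (hKdisj v w h) hv hw
    · simp only [Set.mem_iUnion] at hw
      obtain ⟨e, rfl, he⟩ := hw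
      by_contra h
      exact Set.disjoint_left.1 (hTK e v h) he hv
    · simp only [Set.mem_iUnion] at hv
      obtain ⟨e, rfl, he⟩ := hv
      by_contra h
      exact Set.disjoint_left.1 (hTK e w (Ne.symm h)) he hw
    · simp only [Set.mem_iUnion] at hv hw
      obtain ⟨e, rfl, he⟩ := hv
      obtain ⟨f, rfl, hf⟩ := hw
      by_contra h
      have hef : e ≠ f := by rintro rfl; exact h rfl
      exact Set.disjoint_left.1 (hMdisj e f hef) (hTM e he) (hTM f hf)
  let L : ℤ × ℤ → Option V := fun p => if h : ∃ v, p ∈ B v then some h.choose else none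
  have hL : ∀ p v, L p = some v ↔ p ∈ B v := by
    intro p v
    by_cases h : ∃ v, p ∈ B v
    · simp only [L, dif_pos h, Option.some.injEq]
      constructor
      · rintro rfl; exact h.choose_spec
      · exact fun hv => hBdisj _ _ _ h.choose_spec hv
    · simp only [L, dif_neg h]
      exact ⟨fun h' => by simp at h', fun h' => absurd ⟨v, h'⟩ h⟩
  have hBK : ∀ v, ∀ p ∈ B v, ∃ q ∈ K v,
      Relation.ReflTransGen (fun p q => SquareGrid.Adj p q ∧ p ∈ B v ∧ q ∈ B v) p q := by
    rintro v p (hp | hp)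
    · exact ⟨p, hp, .refl⟩
    · simp only [Set.mem_iUnion] at hp
      obtain ⟨e, rfl, x, hx, hxM, h⟩ := hp
      refine ⟨x, hx, reflTransGen_symm ?_⟩
      suffices p ∈ T e ∧
        Relation.ReflTransGen (fun p q => SquareGrid.Adj p q ∧ p ∈ B (s e) ∧ q ∈ B (s e)) x p from
        this.2
      induction h with
      | refl => exact ⟨⟨x, hx, hxM, .refl⟩, .refl⟩
      | tail h1 h2 ih =>
        exact ⟨⟨x, hx, hxM, h1.tail h2⟩, ih.2.tail ⟨h2.1, hTB e ih.1,
          hTB e ⟨x, hx, hxM, h1.tail h2⟩⟩⟩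
  refine ⟨L, ⟨?_, ?_, ?_⟩⟩
  · refine ((Set.finite_iUnion hKfin).union (Set.finite_iUnion hMfin)).subset ?_
    intro p hp
    obtain ⟨v, hv⟩ := Option.ne_none_iff_exists'.1 hp
    rw [hL] at hv
    rcases hv with h | h
    · exact Or.inl (Set.mem_iUnion.2 ⟨v, h⟩)
    · simp only [Set.mem_iUnion] at h
      obtain ⟨e, rfl, he⟩ := h
      exact Or.inr (Set.mem_iUnion.2 ⟨e, hTM e he⟩)
  · intro v p q hp hq
    simp only [hL] at hp hq ⊢
    obtain ⟨p', hp', h1⟩ := hBK v p hp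
    obtain ⟨q', hq', h2⟩ := hBK v q hq
    exact (h1.trans (reflTransGen_mono Set.subset_union_left (hKconn v p' hp' q' hq'))).trans
      (reflTransGen_symm h2)
  · intro u v huv
    obtain ⟨a, ha, b, hb, hab⟩ := hTadj ⟨s(u, v), huv⟩
    have h := hst ⟨s(u, v), huv⟩
    have ha' := hTB _ ha
    have hb' : b ∈ B _ := Or.inl hb
    rcases Sym2.eq_iff.1 h with ⟨h1, h2⟩ | ⟨h1, h2⟩
    · rw [← h1] at ha'
      rw [← h2] at hb'
      exact ⟨a, b, hab, (hL _ _).2 ha', (hL _ _).2 hb'⟩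
    · rw [← h1] at hb'
      rw [← h2] at ha'
      exact ⟨b, a, hab.symm, (hL _ _).2 hb', (hL _ _).2 ha'⟩

end SimpleGraph

/-! ### Approximation of plane sets by grid points. -/

namespace SquareGrid

/-- The points of the grid of mesh `δ` that approximate a subset of the plane. -/
def approx (δ : ℝ) (K : Set (EuclideanSpace ℝ (Fin 2))) : Set (ℤ × ℤ) :=
  {p | ∃ x ∈ K, |x 0 - δ * p.1| < δ ∧ |x 1 - δ * p.2| < δ}

lemma abs_sub_mul_floor_lt {δ : ℝ} (hδ : 0 < δ) (x : ℝ) : |x - δ * ⌊x / δ⌋| < δ := by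
  have h1 := Int.floor_le (x / δ)
  have h2 := Int.lt_floor_add_one (x / δ)
  rw [le_div_iff₀ hδ] at h1
  rw [div_lt_iff₀ hδ] at h2
  rw [abs_lt]
  constructor <;> nlinarith

lemma eq_or_eq_of_abs_sub_lt {δ x : ℝ} (hδ : 0 < δ) {i : ℤ} (h : |x - δ * i| < δ) :
    i = ⌊x / δ⌋ ∨ i = ⌊x / δ⌋ + 1 := by
  have h1 := Int.floor_le (x / δ)
  have h2 := Int.lt_floor_add_one (x / δ)
  rw [le_div_iff₀ hδ] at h1
  rw [div_lt_iff₀ hδ] at h2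
  rw [abs_lt] at h
  have h3 : (⌊x / δ⌋ : ℝ) - 1 < i := by nlinarith
  have h4 : (i : ℝ) < ⌊x / δ⌋ + 2 := by nlinarith
  have h5 : ⌊x / δ⌋ - 1 < i := by exact_mod_cast h3
  have h6 : i < ⌊x / δ⌋ + 2 := by exact_mod_cast h4
  omega

lemma approx_mono {δ : ℝ} {K K' : Set (EuclideanSpace ℝ (Fin 2))} (h : K ⊆ K') :
    approx δ K ⊆ approx δ K' := fun _ ⟨x, hx, hp⟩ => ⟨x, h hx, hp⟩

/-- The approximating points are among the four corners of the grid square containing `x`; one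
horizontal and one vertical step reach any of them from the lower left corner. -/
lemma connected_approx_singleton {δ : ℝ} (hδ : 0 < δ) (x : EuclideanSpace ℝ (Fin 2)) :
    Connected (approx δ {x}) := by
  set i := ⌊x 0 / δ⌋
  set j := ⌊x 1 / δ⌋
  have h0 : (i, j) ∈ approx δ {x} :=
    ⟨x, rfl, abs_sub_mul_floor_lt hδ _, abs_sub_mul_floor_lt hδ _⟩
  suffices h : ∀ p ∈ approx δ {x}, Relation.ReflTransGen
      (fun p q => Adj p q ∧ p ∈ approx δ {x} ∧ q ∈ approx δ {x}) (i, j) p from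
    fun p hp q hq => (reflTransGen_symm (h p hp)).trans (h q hq)
  rintro ⟨k, l⟩ ⟨y, rfl, h1, h2⟩
  have h3 : (k, j) ∈ approx δ {y} := ⟨y, rfl, h1, abs_sub_mul_floor_lt hδ _⟩
  have h4 : (k, l) ∈ approx δ {y} := ⟨y, rfl, h1, h2⟩
  have h5 : Relation.ReflTransGen
      (fun p q => Adj p q ∧ p ∈ approx δ {y} ∧ q ∈ approx δ {y}) (i, j) (k, j) := by
    rcases eq_or_eq_of_abs_sub_lt hδ h1 with rfl | rfl
    · exact .refl
    · exact .single ⟨adj_right _ _, h0, h3⟩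
  refine h5.trans ?_
  rcases eq_or_eq_of_abs_sub_lt hδ h2 with rfl | rfl
  · exact .refl
  · exact .single ⟨adj_up _ _, h3, h4⟩

/-- The open squares `U r` cover `K`. If `q` were not reachable from `p`, the squares of reachable
and of unreachable grid points would form two open sets, by preconnectedness with a common point of
`K`; around that point `connected_approx_singleton` joins the two kinds. -/
lemma connected_approx {δ : ℝ} (hδ : 0 < δ) {K : Set (EuclideanSpace ℝ (Fin 2))}
    (hK : IsPreconnected K) : Connected (approx δ K) := by
  intro p hp q hq
  set R : ℤ × ℤ → ℤ × ℤ → Prop :=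
    Relation.ReflTransGen (fun p q => Adj p q ∧ p ∈ approx δ K ∧ q ∈ approx δ K) with hR
  let U : ℤ × ℤ → Set (EuclideanSpace ℝ (Fin 2)) :=
    fun p => {x | |x 0 - δ * p.1| < δ ∧ |x 1 - δ * p.2| < δ}
  have hU : ∀ p, IsOpen (U p) := fun p => by
    have h1 : Continuous fun x : EuclideanSpace ℝ (Fin 2) => |x 0 - δ * p.1| := by fun_prop
    have h2 : Continuous fun x : EuclideanSpace ℝ (Fin 2) => |x 1 - δ * p.2| := by fun_prop
    exact (isOpen_lt h1 continuous_const).inter (isOpen_lt h2 continuous_const)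
  by_contra hpq
  obtain ⟨x, hxK, hx1, hx2⟩ := hK (⋃ (r) (_ : R p r), U r) (⋃ (r) (_ : ¬ R p r), U r)
    (isOpen_iUnion fun r => isOpen_iUnion fun _ => hU r)
    (isOpen_iUnion fun r => isOpen_iUnion fun _ => hU r)
    (fun x _ => by
      have : x ∈ U (⌊x 0 / δ⌋, ⌊x 1 / δ⌋) :=
        ⟨abs_sub_mul_floor_lt hδ _, abs_sub_mul_floor_lt hδ _⟩
      by_cases h : R p (⌊x 0 / δ⌋, ⌊x 1 / δ⌋)
      · left; simp only [Set.mem_iUnion]; exact ⟨_, h, this⟩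
      · right; simp only [Set.mem_iUnion]; exact ⟨_, h, this⟩)
    (by
      obtain ⟨x, hx, hp⟩ := hp
      refine ⟨x, hx, ?_⟩
      simp only [Set.mem_iUnion]
      exact ⟨p, .refl, hp⟩)
    (by
      obtain ⟨x, hx, hq⟩ := hq
      refine ⟨x, hx, ?_⟩
      simp only [Set.mem_iUnion]
      exact ⟨q, hpq, hq⟩)
  simp only [Set.mem_iUnion] at hx1 hx2
  obtain ⟨a, ha, hxa⟩ := hx1
  obtain ⟨b, hb, hxb⟩ := hx2
  exact hb (ha.trans (reflTransGen_mono (approx_mono (Set.singleton_subset_iff.2 hxK))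
    (connected_approx_singleton hδ x a ⟨x, rfl, hxa⟩ b ⟨x, rfl, hxb⟩)))

lemma finite_approx {δ : ℝ} (hδ : 0 < δ) {K : Set (EuclideanSpace ℝ (Fin 2))}
    (hK : IsCompact K) : (approx δ K).Finite := by
  obtain ⟨C, hC⟩ := hK.isBounded.exists_norm_le
  have hc : ∀ x ∈ K, ∀ i, |x i| ≤ C := fun x hx i =>
    (by simpa using PiLp.norm_apply_le x i : |x i| ≤ ‖x‖).trans (hC x hx)
  have key : ∀ (y : ℝ) (k : ℤ), |y| ≤ C → |y - δ * k| < δ →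
      k ∈ Set.Icc (-⌈C / δ + 1⌉) ⌈C / δ + 1⌉ := by
    intro y k hy hk
    have h1 := Int.le_ceil (C / δ + 1)
    have h2 : |(k : ℝ)| ≤ C / δ + 1 := by
      rw [div_add_one hδ.ne', le_div_iff₀ hδ, ← abs_of_pos hδ, ← abs_mul, abs_of_pos hδ]
      rw [abs_le] at *
      rw [abs_lt] at hk
      constructor <;> nlinarith
    have h3 := abs_le.1 (h2.trans h1)
    constructor
    · exact_mod_cast h3.1
    · exact_mod_cast h3.2
  refine ((Set.finite_Icc (-⌈C / δ + 1⌉) ⌈C / δ + 1⌉).prod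
    (Set.finite_Icc (-⌈C / δ + 1⌉) ⌈C / δ + 1⌉)).subset ?_
  rintro ⟨k, l⟩ ⟨x, hx, h1, h2⟩
  exact ⟨key _ _ (hc x hx 0) h1, key _ _ (hc x hx 1) h2⟩

open Filter Topology in
-- Disjoint compact sets have disjoint `ε`-thickenings, while a common grid point gives points of
-- the two sets whose coordinates differ by less than `2δ`.
lemma eventually_disjoint_approx {K K' : Set (EuclideanSpace ℝ (Fin 2))}
    (hK : IsCompact K) (hK' : IsCompact K') (h : Disjoint K K') :
    ∀ᶠ δ in 𝓝[>] (0 : ℝ), Disjoint (approx δ K) (approx δ K') := by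
  obtain ⟨ε, hε, hd⟩ := h.exists_thickenings hK hK'.isClosed
  filter_upwards [Ioo_mem_nhdsGT (show (0 : ℝ) < ε / 4 by positivity)] with δ hδ
  refine Set.disjoint_left.2 ?_
  rintro p ⟨x, hx, h1, h2⟩ ⟨y, hy, h3, h4⟩
  refine Set.disjoint_left.1 hd (Metric.self_subset_thickening hε _ hx)
    (Metric.mem_thickening_iff.2 ⟨y, hy, ?_⟩)
  have hδ1 := hδ.2
  have hδ0 := hδ.1
  rw [EuclideanSpace.dist_eq, Fin.sum_univ_two, Real.dist_eq, Real.dist_eq,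
    Real.sqrt_lt' hε, sq_abs, sq_abs]
  have h5 : |x 0 - y 0| < ε / 2 := by
    rw [abs_lt] at *; constructor <;> linarith
  have h6 : |x 1 - y 1| < ε / 2 := by
    rw [abs_lt] at *; constructor <;> linarith
  have h7 := sq_lt_sq' (abs_lt.1 h5).1 (abs_lt.1 h5).2
  have h8 := sq_lt_sq' (abs_lt.1 h6).1 (abs_lt.1 h6).2
  nlinarith

lemma approx_inter_nonempty {δ : ℝ} (hδ : 0 < δ) {K K' : Set (EuclideanSpace ℝ (Fin 2))}
    (h : (K ∩ K').Nonempty) : (approx δ K ∩ approx δ K').Nonempty := by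
  obtain ⟨x, hx, hx'⟩ := h
  exact ⟨(⌊x 0 / δ⌋, ⌊x 1 / δ⌋),
    ⟨x, hx, abs_sub_mul_floor_lt hδ _, abs_sub_mul_floor_lt hδ _⟩,
    ⟨x, hx', abs_sub_mul_floor_lt hδ _, abs_sub_mul_floor_lt hδ _⟩⟩

end SquareGrid

/-! ### From planar embeddings to grid minors, and the planar edge bound. -/

namespace SimpleGraph

open Filter Topology unitInterval SquareGrid in
/-- A planar graph is a minor of the square grid. -/
theorem PlanarEmbedding.exists_gridModel {V : Type*} [Finite V] {G : SimpleGraph V}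
    (E : G.PlanarEmbedding) : ∃ L, G.GridModel L := by
  have hex : ∀ e : G.edgeSet, ∃ u v, ∃ γ : _root_.Path (E.pos u) (E.pos v), (e : Sym2 V) = s(u, v) ∧
      Function.Injective γ ∧ Set.range γ = E.arc e := by
    rintro ⟨⟨u, v⟩, h⟩
    obtain ⟨γ, h1, h2⟩ := E.arc_isArc u v h
    exact ⟨u, v, γ, rfl, h1, h2⟩
  choose s t γ hst hinj hrange using hex
  -- Each arc is cut into thirds. The outer thirds join the compact sets `K` of the end vertices;
  -- the middle third `M e` contains no vertex, so it is disjoint from the other arcs.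
  let a : I := ⟨1 / 3, by norm_num, by norm_num⟩
  let b : I := ⟨2 / 3, by norm_num, by norm_num⟩
  have hab : a < b := by rw [← Subtype.coe_lt_coe]; norm_num [a, b]
  have ha0 : 0 < a := by rw [← Subtype.coe_lt_coe]; norm_num [a]
  have hb1 : b < 1 := by rw [← Subtype.coe_lt_coe]; norm_num [b]
  have hmem : ∀ e x, γ e x ∈ E.arc e := fun e x => hrange e ▸ Set.mem_range_self x
  -- vertices on an arc
  have hpos : ∀ e x w, γ e x = E.pos w → (x = 0 ∧ w = s e) ∨ (x = 1 ∧ w = t e) := by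
    intro e x w h
    have hw := E.mem_of_pos_mem_arc w e (h ▸ hmem e x)
    rw [hst, Sym2.mem_iff] at hw
    rcases hw with rfl | rfl
    · exact Or.inl ⟨hinj e (h.trans (γ e).source.symm), rfl⟩
    · exact Or.inr ⟨hinj e (h.trans (γ e).target.symm), rfl⟩
  have hmeet : ∀ e f x y, e ≠ f → γ e x = γ f y → ∃ w, γ e x = E.pos w := by
    intro e f x y hef h
    obtain ⟨w, -, -, hw⟩ := E.arc_inter_arc e f hef _ (hmem e x) (h ▸ hmem f y)
    exact ⟨w, hw⟩
  let K : V → Set (EuclideanSpace ℝ (Fin 2)) := fun v => {E.pos v} ∪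
    ((⋃ (e : G.edgeSet) (_ : s e = v), γ e '' Set.Iic a) ∪
      ⋃ (e : G.edgeSet) (_ : t e = v), γ e '' Set.Ici b)
  let M : G.edgeSet → Set (EuclideanSpace ℝ (Fin 2)) := fun e => γ e '' Set.Icc a b
  have hKmem : ∀ v x, x ∈ K v → x = E.pos v ∨ (∃ e, s e = v ∧ ∃ y ≤ a, γ e y = x) ∨
      ∃ e, t e = v ∧ ∃ y ≥ b, γ e y = x := by
    rintro v x (h | h | h)
    · exact Or.inl h
    · simp only [Set.mem_iUnion] at h
      obtain ⟨e, he, y, hy, rfl⟩ := h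
      exact Or.inr (Or.inl ⟨e, he, y, hy, rfl⟩)
    · simp only [Set.mem_iUnion] at h
      obtain ⟨e, he, y, hy, rfl⟩ := h
      exact Or.inr (Or.inr ⟨e, he, y, hy, rfl⟩)
  -- a position in `K v` is that of `v`
  have hKpos : ∀ v w, E.pos w ∈ K v → w = v := by
    intro v w h
    rcases hKmem v _ h with h | ⟨e, rfl, y, hy, h⟩ | ⟨e, rfl, y, hy, h⟩
    · exact E.pos_injective h
    · rcases hpos e y w h with h | h
      · exact h.2
      · exact absurd (h.1 ▸ hy) (not_le.2 (hab.trans hb1))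
    · rcases hpos e y w h with h | h
      · exact absurd (h.1 ▸ hy) (not_le.2 (ha0.trans hab))
      · exact h.2
  have hKarc : ∀ v e x, γ e x ∈ K v → (∃ w, γ e x = E.pos w) ∨ (s e = v ∧ x ≤ a) ∨
      (t e = v ∧ b ≤ x) := by
    intro v e x h
    rcases hKmem v _ h with h | ⟨f, hf, y, hy, h⟩ | ⟨f, hf, y, hy, h⟩
    · exact Or.inl ⟨v, h⟩
    · by_cases hef : e = f
      · subst hef
        exact Or.inr (Or.inl ⟨hf, hinj e h ▸ hy⟩)
      · exact Or.inl (hmeet e f x y hef h.symm)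
    · by_cases hef : e = f
      · subst hef
        exact Or.inr (Or.inr ⟨hf, hinj e h ▸ hy⟩)
      · exact Or.inl (hmeet e f x y hef h.symm)
  have hMpos : ∀ e x, x ∈ Set.Icc a b → ∀ w, γ e x ≠ E.pos w := by
    intro e x hx w h
    rcases hpos e x w h with h | h
    · exact absurd (h.1 ▸ hx.1) (not_le.2 ha0)
    · exact absurd (h.1 ▸ hx.2) (not_le.2 hb1)
  have hKdisj : ∀ v w, v ≠ w → Disjoint (K v) (K w) := by
    intro v w hvw
    refine Set.disjoint_left.2 fun x hv hw => hvw ?_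
    have aux : ∀ u, x = E.pos u → v = w := fun u hu => by
      rw [hu] at hv hw
      rw [← hKpos v u hv, ← hKpos w u hw]
    rcases hKmem v x hv with h | ⟨e, he, y, hy, rfl⟩ | ⟨e, he, y, hy, rfl⟩
    · exact aux _ h
    · rcases hKarc w e y hw with ⟨u, hu⟩ | ⟨h, -⟩ | ⟨-, h⟩
      · exact aux u hu
      · exact he.symm.trans h
      · exact absurd (h.trans hy) (not_le.2 hab)
    · rcases hKarc w e y hw with ⟨u, hu⟩ | ⟨-, h⟩ | ⟨h, -⟩
      · exact aux u hu
      · exact absurd (le_trans hy h) (not_le.2 hab)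
      · exact he.symm.trans h
  have hMdisj : ∀ e f, e ≠ f → Disjoint (M e) (M f) := by
    intro e f hef
    refine Set.disjoint_left.2 ?_
    rintro _ ⟨x, hx, rfl⟩ ⟨y, -, h⟩
    obtain ⟨w, hw⟩ := hmeet e f x y hef h.symm
    exact hMpos e x hx w hw
  have hMK : ∀ (e : G.edgeSet) w, w ∉ (e : Sym2 V) → Disjoint (M e) (K w) := by
    intro e w hw
    rw [hst, Sym2.mem_iff, not_or] at hw
    refine Set.disjoint_left.2 ?_
    rintro _ ⟨x, hx, rfl⟩ h
    rcases hKarc w e x h with ⟨u, hu⟩ | ⟨h, -⟩ | ⟨h, -⟩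
    · exact hMpos e x hx u hu
    · exact hw.1 h.symm
    · exact hw.2 h.symm
  have hKcpt : ∀ v, IsCompact (K v) := fun v =>
    isCompact_singleton.union ((isCompact_iUnion fun e => isCompact_iUnion fun _ =>
      isClosed_Iic.isCompact.image (γ e).continuous).union
      (isCompact_iUnion fun e => isCompact_iUnion fun _ =>
      isClosed_Ici.isCompact.image (γ e).continuous))
  have hMcpt : ∀ e, IsCompact (M e) := fun e => isCompact_Icc.image (γ e).continuous
  have hMconn : ∀ e, IsPreconnected (M e) := fun e =>
    isPreconnected_Icc.image _ (γ e).continuous.continuousOn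
  have hsub1 : ∀ e, γ e '' Set.Iic a ⊆ K (s e) := fun e x hx =>
    Or.inr (Or.inl (by simp only [Set.mem_iUnion]; exact ⟨e, rfl, hx⟩))
  have hsub2 : ∀ e, γ e '' Set.Ici b ⊆ K (t e) := fun e x hx =>
    Or.inr (Or.inr (by simp only [Set.mem_iUnion]; exact ⟨e, rfl, hx⟩))
  have hKconn : ∀ v, IsPreconnected (K v) := by
    intro v
    refine isPreconnected_of_forall (E.pos v) fun x hx => ?_
    rcases hKmem v x hx with rfl | ⟨e, rfl, y, hy, rfl⟩ | ⟨e, rfl, y, hy, rfl⟩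
    · exact ⟨{E.pos v}, by simp [K], rfl, rfl, isPreconnected_singleton⟩
    · exact ⟨_, hsub1 e, ⟨0, ha0.le, (γ e).source⟩, ⟨y, hy, rfl⟩,
        isPreconnected_Iic.image _ (γ e).continuous.continuousOn⟩
    · exact ⟨_, hsub2 e, ⟨1, hb1.le, (γ e).target⟩, ⟨y, hy, rfl⟩,
        isPreconnected_Ici.image _ (γ e).continuous.continuousOn⟩
  -- There are finitely many pairs of disjoint compact sets, so one mesh serves all of them.
  have hev : ∀ᶠ δ in 𝓝[>] (0 : ℝ), 0 < δ ∧
      (∀ v w, v ≠ w → Disjoint (approx δ (K v)) (approx δ (K w))) ∧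
      (∀ e f, e ≠ f → Disjoint (approx δ (M e)) (approx δ (M f))) ∧
      ∀ (e : G.edgeSet) w, w ∉ (e : Sym2 V) → Disjoint (approx δ (M e)) (approx δ (K w)) := by
    refine eventually_mem_nhdsWithin.and (Eventually.and ?_ (Eventually.and ?_ ?_))
    · simp only [eventually_all]
      exact fun v w h => eventually_disjoint_approx (hKcpt v) (hKcpt w) (hKdisj v w h)
    · simp only [eventually_all]
      exact fun e f h => eventually_disjoint_approx (hMcpt e) (hMcpt f) (hMdisj e f h)
    · simp only [eventually_all]
      exact fun e w h => eventually_disjoint_approx (hMcpt e) (hKcpt w) (hMK e w h)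
  obtain ⟨δ, hδ, h1, h2, h3⟩ := hev.exists
  exact SimpleGraph.exists_gridModel s t hst (fun v => approx δ (K v)) (fun e => approx δ (M e))
    (fun v => finite_approx hδ (hKcpt v)) (fun v => connected_approx hδ (hKconn v)) h1
    (fun e => finite_approx hδ (hMcpt e)) (fun e => connected_approx hδ (hMconn e)) h2 h3
    (fun e => approx_inter_nonempty hδ
      ⟨γ e a, ⟨a, ⟨le_rfl, hab.le⟩, rfl⟩, hsub1 e ⟨a, le_refl a, rfl⟩⟩)
    (fun e => approx_inter_nonempty hδ
      ⟨γ e b, ⟨b, ⟨hab.le, le_rfl⟩, rfl⟩, hsub2 e ⟨b, le_refl b, rfl⟩⟩)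

lemma not_adj_of_four_le_egirth {V : Type*} {G : SimpleGraph V} (h : 4 ≤ G.egirth) (a b c : V)
    (hab : G.Adj a b) (hbc : G.Adj b c) : ¬ G.Adj c a := by
  intro hca
  have hcyc : (Walk.cons hab (Walk.cons hbc (Walk.cons hca Walk.nil))).IsCycle := by
    rw [Walk.cons_isCycle_iff]
    simp [Walk.cons_isPath_iff, hbc.ne, hca.ne, hab.ne, hab.ne', hca.ne']
  have := h.trans (egirth_le_length hcyc)
  simp at this
  exact absurd this (by decide)

/-- A planar graph of girth at least four on `n ≥ 3` vertices has at most `2 n - 4` edges. -/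
theorem IsPlanar.ncard_edgeSet_add_four_le {V : Type*} [Finite V] {G : SimpleGraph V}
    (hG : G.IsPlanar) (hg : 4 ≤ G.egirth) (hV : 3 ≤ Nat.card V) :
    G.edgeSet.ncard + 4 ≤ 2 * Nat.card V := by
  have := Fintype.ofFinite V
  have := Fintype.ofFinite G.edgeSet
  obtain ⟨E⟩ := hG
  obtain ⟨L, hL⟩ := E.exists_gridModel
  rw [Nat.card_eq_fintype_card] at hV ⊢
  rw [← Nat.card_coe_set_eq, Nat.card_eq_fintype_card]
  exact hL.card_edgeSet_add_four_le hV (not_adj_of_four_le_egirth hg)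

end SimpleGraph

/-! ### Straight-line drawings. -/

namespace SimpleGraph

/-- A straight-line drawing of a graph in the plane. A vertex is treated as a degenerate edge, so
that this includes that the vertices are distinct and lie on no other edge. -/
def IsStraightDrawing {W : Type*} (Γ : SimpleGraph W) (f : W → ℝ × ℝ) : Prop :=
  ∀ a b c d, (a = b ∨ Γ.Adj a b) → (c = d ∨ Γ.Adj c d) →
    ∀ x ∈ segment ℝ (f a) (f b), x ∈ segment ℝ (f c) (f d) →
      s(a, b) = s(c, d) ∨ ∃ w, (w = a ∨ w = b) ∧ (w = c ∨ w = d) ∧ x = f w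

namespace IsStraightDrawing

variable {W : Type*} {Γ : SimpleGraph W} {f : W → ℝ × ℝ}

lemma injective (hf : Γ.IsStraightDrawing f) : Function.Injective f := by
  intro a b h
  rcases hf a a b b (Or.inl rfl) (Or.inl rfl) (f a) (left_mem_segment ℝ _ _)
    (h ▸ left_mem_segment ℝ _ _) with h | ⟨w, h1, h2, -⟩
  · simpa using h
  · grind

lemma eq_or_eq (hf : Γ.IsStraightDrawing f) {a b w : W} (hab : a = b ∨ Γ.Adj a b)
    (hw : f w ∈ segment ℝ (f a) (f b)) : w = a ∨ w = b := by
  rcases hf w w a b (Or.inl rfl) hab (f w) (left_mem_segment ℝ _ _) hw with h | ⟨w', h1, h2, -⟩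
  · left
    rw [Sym2.eq_iff] at h
    grind
  · grind

lemma mono {Γ' : SimpleGraph W} (h : Γ' ≤ Γ) (hf : Γ.IsStraightDrawing f) :
    Γ'.IsStraightDrawing f :=
  fun a b c d hab hcd => hf a b c d (hab.imp_right (h ·)) (hcd.imp_right (h ·))

lemma comp (hf : Γ.IsStraightDrawing f) (φ : ℝ × ℝ →ᵃ[ℝ] ℝ × ℝ) (hφ : Function.Injective φ) :
    Γ.IsStraightDrawing (φ ∘ f) := by
  intro a b c d hab hcd x hx hx'
  simp only [Function.comp_apply] at hx hx' ⊢
  rw [← image_segment] at hx hx'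
  obtain ⟨y, hy, rfl⟩ := hx
  obtain ⟨y', hy', h⟩ := hx'
  rw [hφ h] at hy'
  refine (hf a b c d hab hcd y hy hy').imp_right ?_
  rintro ⟨w, h1, h2, rfl⟩
  exact ⟨w, h1, h2, rfl⟩

/-- A graph with a straight-line drawing is planar. -/
theorem isPlanar (hf : Γ.IsStraightDrawing f) : Γ.IsPlanar := by
  let ι : ℝ × ℝ → EuclideanSpace ℝ (Fin 2) := fun p => !₂[p.1, p.2]
  have hιc : Continuous ι := by
    refine (PiLp.continuous_toLp 2 _).comp (continuous_pi fun i => ?_)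
    fin_cases i
    · exact continuous_fst
    · exact continuous_snd
  have hι : Function.Injective ι := by
    intro p q h
    have h0 := congrArg (fun z => z 0) h
    have h1 := congrArg (fun z => z 1) h
    exact Prod.ext (by simpa [ι] using h0) (by simpa [ι] using h1)
  -- An edge is an unordered pair, so its arc is described through any ordering of its ends;
  -- symmetry of segments makes the choice irrelevant.
  have hmem : ∀ {u v : W} {x}, (∃ a b, s(u, v) = s(a, b) ∧ x ∈ ι '' segment ℝ (f a) (f b)) ↔
      x ∈ ι '' segment ℝ (f u) (f v) := by
    intro u v x
    constructor
    · rintro ⟨a, b, h, hx⟩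
      rcases Sym2.eq_iff.1 h with ⟨rfl, rfl⟩ | ⟨rfl, rfl⟩
      · exact hx
      · rwa [segment_symm]
    · exact fun h => ⟨u, v, rfl, h⟩
  refine ⟨⟨ι ∘ f, fun e => {x | ∃ a b, (e : Sym2 W) = s(a, b) ∧ x ∈ ι '' segment ℝ (f a) (f b)},
    hι.comp hf.injective, ?_, ?_, ?_⟩⟩
  · intro u v h
    refine ⟨⟨⟨fun t => ι (AffineMap.lineMap (f u) (f v) (t : ℝ)), ?_⟩, by simp, by simp⟩, ?_, ?_⟩
    · exact hιc.comp (AffineMap.lineMap_continuous.comp continuous_subtype_val)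
    · intro s t hst
      exact Subtype.ext (AffineMap.lineMap_injective ℝ (hf.injective.ne h.ne) (hι hst))
    · ext x
      refine Iff.trans ?_ hmem.symm
      rw [segment_eq_image_lineMap]
      constructor
      · rintro ⟨t, rfl⟩
        exact ⟨_, ⟨t, t.2, rfl⟩, rfl⟩
      · rintro ⟨_, ⟨t, ht, rfl⟩, rfl⟩
        exact ⟨⟨t, ht⟩, rfl⟩
  · rintro w ⟨⟨u, v⟩, h⟩ hw
    obtain ⟨y, hy, hyw⟩ := hmem.1 hw
    rw [hι hyw] at hy
    exact Sym2.mem_iff.2 (hf.eq_or_eq (Or.inr h) hy)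
  · rintro ⟨⟨a, b⟩, hab⟩ ⟨⟨c, d⟩, hcd⟩ hne x hx hx'
    obtain ⟨y, hy, rfl⟩ := hmem.1 hx
    obtain ⟨y', hy', h⟩ := hmem.1 hx'
    rw [hι h] at hy'
    rcases hf a b c d (Or.inr hab) (Or.inr hcd) y hy hy' with h | ⟨w, h1, h2, rfl⟩
    · exact absurd (Subtype.ext h) hne
    · exact ⟨w, Sym2.mem_iff.2 h1, Sym2.mem_iff.2 h2, rfl⟩

end IsStraightDrawing

/-- The vertices of a plane drawing of the complete graph on four vertices. -/
def tetraPos : Fin 4 → ℝ × ℝ := ![(0, 0), (2, 0), (1, 2), (1, 1)]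

/-- Points of the drawing `tetraPos` have unique barycentric coordinates. -/
lemma tetraPos_coord_unique {μ ν : Fin 4 → ℝ} (hμ : ∀ i, 0 ≤ μ i) (hν : ∀ i, 0 ≤ ν i)
    (hμ1 : ∑ i, μ i = 1) (hν1 : ∑ i, ν i = 1) (hμ0 : μ 0 = 0 ∨ μ 1 = 0 ∨ μ 2 = 0)
    (hν0 : ν 0 = 0 ∨ ν 1 = 0 ∨ ν 2 = 0) (h : ∑ i, μ i • tetraPos i = ∑ i, ν i • tetraPos i) :
    μ = ν := by
  have h1 := congrArg Prod.fst h
  have h2 := congrArg Prod.snd h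
  simp only [Fin.sum_univ_four] at h1 h2 hμ1 hν1
  simp [tetraPos] at h1 h2
  have a0 := hμ 0
  have a1 := hμ 1
  have a2 := hμ 2
  have b0 := hν 0
  have b1 := hν 1
  have b2 := hν 2
  -- The four points satisfy one affine relation, with coefficients `(1, 1, 2, -4)`. If `μ - ν` were
  -- a nonzero multiple of it, `μ` or `ν` would be positive at all of `0`, `1`, `2`.
  have h3 : μ 3 = ν 3 := by
    rcases hμ0 with h | h | h <;> rcases hν0 with h' | h' | h' <;> linarith
  ext i
  fin_cases i
  · change μ 0 = ν 0; linarith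
  · change μ 1 = ν 1; linarith
  · change μ 2 = ν 2; linarith
  · exact h3

/-- A segment involves at most two indices, so one of the outer indices `0`, `1`, `2` is missing, as
`tetraPos_coord_unique` requires. -/
lemma tetraPos_coord (i j : Fin 4) {a b : ℝ} (ha : 0 ≤ a) (hb : 0 ≤ b) (hab : a + b = 1)
    {μ : Fin 4 → ℝ} (hμ : μ = Pi.single i a + Pi.single j b) :
    (∀ k, 0 ≤ μ k) ∧ ∑ k, μ k = 1 ∧ (μ 0 = 0 ∨ μ 1 = 0 ∨ μ 2 = 0) ∧
      ∑ k, μ k • tetraPos k = a • tetraPos i + b • tetraPos j := by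
  subst hμ
  refine ⟨fun k => ?_, ?_, ?_, ?_⟩
  · have h1 : (0 : Fin 4 → ℝ) ≤ Pi.single i a := Pi.single_nonneg.2 ha
    have h2 : (0 : Fin 4 → ℝ) ≤ Pi.single j b := Pi.single_nonneg.2 hb
    exact add_nonneg (h1 k) (h2 k)
  · simp [Finset.sum_add_distrib, hab]
  · have : ∀ i j : Fin 4, (0 ≠ i ∧ 0 ≠ j) ∨ (1 ≠ i ∧ 1 ≠ j) ∨ (2 ≠ i ∧ 2 ≠ j) := by decide
    rcases this i j with h | h | h
    · left; simp [Pi.single_eq_of_ne h.1, Pi.single_eq_of_ne h.2]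
    · right; left; simp [Pi.single_eq_of_ne h.1, Pi.single_eq_of_ne h.2]
    · right; right; simp [Pi.single_eq_of_ne h.1, Pi.single_eq_of_ne h.2]
  · simp only [Pi.add_apply, add_smul, Finset.sum_add_distrib]
    rw [Finset.sum_eq_single i (fun k _ hk => by rw [Pi.single_eq_of_ne hk, zero_smul]) (by simp),
      Finset.sum_eq_single j (fun k _ hk => by rw [Pi.single_eq_of_ne hk, zero_smul]) (by simp)]
    simp

/-- By uniqueness of coordinates, the support of a common point lies in both index pairs. A support
of one index is a common vertex; one of two indices forces the edges to coincide. -/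
lemma isStraightDrawing_tetraPos : (⊤ : SimpleGraph (Fin 4)).IsStraightDrawing tetraPos := by
  rintro i j k l - - x ⟨a, b, ha, hb, hab, rfl⟩ ⟨c, d, hc, hd, hcd, h⟩
  obtain ⟨h1, h2, h3, h4⟩ := tetraPos_coord i j ha hb hab rfl
  obtain ⟨h5, h6, h7, h8⟩ := tetraPos_coord k l hc hd hcd rfl
  have key := tetraPos_coord_unique h1 h5 h2 h6 h3 h7 (h4.trans (h.symm.trans h8.symm))
  have hmem : ∀ m, (Pi.single i a + Pi.single j b : Fin 4 → ℝ) m ≠ 0 → m = k ∨ m = l := by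
    intro m hm
    by_contra hn
    rw [not_or] at hn
    rw [key] at hm
    simp [Pi.single_eq_of_ne hn.1, Pi.single_eq_of_ne hn.2] at hm
  by_cases hij : i = j
  · subst hij
    refine Or.inr ⟨i, Or.inl rfl, hmem i ?_, ?_⟩
    · simp [hab]
    · rw [← add_smul, hab, one_smul]
  by_cases ha0 : a = 0
  · subst ha0
    obtain rfl : b = 1 := by linarith
    exact Or.inr ⟨j, Or.inr rfl, hmem j (by simp), by simp⟩
  by_cases hb0 : b = 0
  · subst hb0
    obtain rfl : a = 1 := by linarith
    exact Or.inr ⟨i, Or.inl rfl, hmem i (by simp), by simp⟩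
  have hi := hmem i (by simpa [Pi.single_eq_of_ne hij] using ha0)
  have hj := hmem j (by simpa [Pi.single_eq_of_ne (Ne.symm hij)] using hb0)
  left
  rw [Sym2.eq_iff]
  grind

end SimpleGraph

/-! ### An empty triangle beside an edge of a drawing. -/

namespace SimpleGraph

open Filter Topology in
/-- A segment starting at the corner `A` of a thin triangle with a horizontal side meets the
triangle only in that side. -/
lemma eventually_thin_corner {A B : ℝ × ℝ} (hA : A.2 = 0) (s : ℝ) :
    ∀ᶠ h in 𝓝[>] (0 : ℝ), ∀ y ∈ segment ℝ A B, 0 ≤ y.2 → y.2 ≤ h * (s * (y.1 - A.1)) →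
      y = A ∨ y.2 = 0 := by
  rcases lt_trichotomy B.2 0 with hB | hB | hB
  · refine Eventually.of_forall fun h y hy h0 _ => Or.inr ?_
    obtain ⟨a, b, ha, hb, hab, rfl⟩ := hy
    simp only [Prod.snd_add, Prod.smul_snd, hA, smul_eq_mul, mul_zero, zero_add] at h0 ⊢
    exact le_antisymm (mul_nonpos_of_nonneg_of_nonpos hb hB.le) h0
  · refine Eventually.of_forall fun h y hy _ _ => Or.inr ?_
    obtain ⟨a, b, ha, hb, hab, rfl⟩ := hy
    simp [hA, hB]
  -- Below this bound the segment rises faster than the side of the triangle, so it leaves the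
  -- triangle immediately.
  · have hpos : 0 < B.2 / (|s * (B.1 - A.1)| + 1) := by positivity
    filter_upwards [Ioo_mem_nhdsGT hpos] with h hh y hy h0 h1
    obtain ⟨a, b, ha, hb, hab, rfl⟩ := hy
    left
    obtain rfl : a = 1 - b := by linarith
    simp only [Prod.snd_add, Prod.smul_snd, Prod.fst_add, Prod.smul_fst, hA, smul_eq_mul,
      mul_zero, zero_add] at h1
    have h2 := hh.2
    rw [lt_div_iff₀ (by positivity)] at h2
    have h3 : h * (s * (B.1 - A.1)) < B.2 := by
      have := mul_le_mul_of_nonneg_left (le_abs_self (s * (B.1 - A.1))) hh.1.le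
      nlinarith [hh.1]
    have h4 : b * (B.2 - h * (s * (B.1 - A.1))) ≤ 0 := by nlinarith
    have h5 : b = 0 := by
      refine le_antisymm ?_ hb
      by_contra hb'
      exact absurd h4 (not_le.2 (mul_pos (not_le.1 hb') (by linarith)))
    simp [h5]

open Filter Topology in
/-- A segment that meets the segment from `(0, 0)` to `(2, 0)` at most in a common end meets
thin triangles over it at most in the ends. -/
lemma eventually_thin {A B : ℝ × ℝ}
    (h : ∀ y ∈ segment ℝ A B, y ∈ segment ℝ (0, 0) (2, 0) →
      (y = (0, 0) ∧ (A = (0, 0) ∨ B = (0, 0))) ∨ (y = (2, 0) ∧ (A = (2, 0) ∨ B = (2, 0)))) :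
    ∀ᶠ ε in 𝓝[>] (0 : ℝ), ∀ y ∈ segment ℝ A B, 0 ≤ y.2 → y.2 ≤ ε * y.1 →
      y.2 ≤ ε * (2 - y.1) → y = (0, 0) ∨ y = (2, 0) := by
  have hseg : ∀ y : ℝ × ℝ, y.2 = 0 → 0 ≤ y.1 → y.1 ≤ 2 → y ∈ segment ℝ ((0, 0) : ℝ × ℝ) (2, 0) :=
    fun y h0 h1 h2 => ⟨1 - y.1 / 2, y.1 / 2, by linarith, by linarith, by ring,
      Prod.ext (by simp) (by simp [h0])⟩
  have hfin : ∀ ε > 0, ∀ y ∈ segment ℝ A B, y.2 = 0 → y.2 ≤ ε * y.1 → y.2 ≤ ε * (2 - y.1) →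
      y = (0, 0) ∨ y = (2, 0) := by
    intro ε hε y hy h0 h1 h2
    rw [h0] at h1 h2
    have h3 := nonneg_of_mul_nonneg_right h1 hε
    have h4 := nonneg_of_mul_nonneg_right h2 hε
    exact (h y hy (hseg y h0 h3 (by linarith))).imp And.left And.left
  have hcorner : ∀ A' B' : ℝ × ℝ, segment ℝ A B = segment ℝ A' B' →
      A' = (0, 0) ∨ A' = (2, 0) → ∀ᶠ ε in 𝓝[>] (0 : ℝ), ∀ y ∈ segment ℝ A B, 0 ≤ y.2 →
        y.2 ≤ ε * y.1 → y.2 ≤ ε * (2 - y.1) → y = (0, 0) ∨ y = (2, 0) := by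
    rintro A' B' hAB (rfl | rfl)
    · filter_upwards [eventually_thin_corner (A := (0, 0)) (B := B') rfl 1, self_mem_nhdsWithin]
        with ε h1 hε y hy hy0 hy1 hy2
      rcases h1 y (hAB ▸ hy) hy0 (by simpa using hy1) with h | h
      · exact Or.inl h
      · exact hfin ε hε y hy h hy1 hy2
    · filter_upwards [eventually_thin_corner (A := (2, 0)) (B := B') rfl (-1), self_mem_nhdsWithin]
        with ε h1 hε y hy hy0 hy1 hy2
      rcases h1 y (hAB ▸ hy) hy0 (by simpa using hy2) with h | h
      · exact Or.inr h
      · exact hfin ε hε y hy h hy1 hy2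
  by_cases hA : A = (0, 0) ∨ A = (2, 0)
  · exact hcorner A B rfl hA
  by_cases hB : B = (0, 0) ∨ B = (2, 0)
  · exact hcorner B A (segment_symm ℝ A B) hB
  have hcpt : IsCompact (segment ℝ A B) := by
    rw [segment_eq_image_lineMap]
    exact isCompact_Icc.image AffineMap.lineMap_continuous
  -- The function is the `ℓ¹` distance to the base, here with a positive minimum on the segment. In
  -- the thin triangle it is at most `ε`.
  obtain ⟨z, hz, hmin⟩ := hcpt.exists_isMinOn ⟨A, left_mem_segment ℝ A B⟩
    (f := fun y : ℝ × ℝ => |y.2| + (max 0 (-y.1) + max 0 (y.1 - 2))) (by fun_prop)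
  have hpos : 0 < |z.2| + (max 0 (-z.1) + max 0 (z.1 - 2)) := by
    by_contra hn
    have h1 := abs_nonneg z.2
    have h2 := le_max_left 0 (-z.1)
    have h3 := le_max_left 0 (z.1 - 2)
    have h4 := le_max_right 0 (-z.1)
    have h5 := le_max_right 0 (z.1 - 2)
    have h6 : |z.2| = 0 := by linarith
    have := h z hz (hseg z (abs_eq_zero.1 h6) (by linarith) (by linarith))
    tauto
  filter_upwards [Ioo_mem_nhdsGT (half_pos hpos)] with ε hε y hy hy0 hy1 hy2
  exfalso
  have h1 := isMinOn_iff.1 hmin y hy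
  have h3 := nonneg_of_mul_nonneg_right (hy0.trans hy1) hε.1
  have h4 := nonneg_of_mul_nonneg_right (hy0.trans hy2) hε.1
  rw [abs_of_nonneg hy0, max_eq_left (b := -y.1) (by linarith),
    max_eq_left (b := y.1 - 2) (by linarith)] at h1
  have h5 := hε.2
  nlinarith [hε.1]

/-- An affine map of the plane given by a matrix and the point sent to the origin. -/
def planeMap (a b c d : ℝ) (P : ℝ × ℝ) : ℝ × ℝ →ᵃ[ℝ] ℝ × ℝ where
  toFun z := (a * (z.1 - P.1) + b * (z.2 - P.2), c * (z.1 - P.1) + d * (z.2 - P.2))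
  linear :=
    { toFun := fun z => (a * z.1 + b * z.2, c * z.1 + d * z.2)
      map_add' := fun x y => by ext <;> simp <;> ring
      map_smul' := fun r x => by ext <;> simp <;> ring }
  map_vadd' p v := by ext <;> simp <;> ring

lemma planeMap_apply (a b c d : ℝ) (P z : ℝ × ℝ) : planeMap a b c d P z =
    (a * (z.1 - P.1) + b * (z.2 - P.2), c * (z.1 - P.1) + d * (z.2 - P.2)) := rfl

lemma planeMap_injective {a b c d : ℝ} (h : a * d - b * c ≠ 0) (P : ℝ × ℝ) :
    Function.Injective (planeMap a b c d P) := by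
  intro x y hxy
  simp only [planeMap_apply, Prod.mk.injEq] at hxy
  obtain ⟨h1, h2⟩ := hxy
  refine Prod.ext (mul_left_cancel₀ h ?_) (mul_left_cancel₀ h ?_)
  · linear_combination d * h1 - b * h2
  · linear_combination a * h2 - c * h1

open Filter Topology in
/-- A straight-line drawing can be transformed such that a given edge joins `(0, 0)` to `(2, 0)`
and the triangle with these corners and `(1, 2)` is free. -/
lemma IsStraightDrawing.exists_free_triangle {W : Type*} [Finite W] {Γ : SimpleGraph W}
    {f : W → ℝ × ℝ} (hf : Γ.IsStraightDrawing f) {u v : W} (huv : Γ.Adj u v) :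
    ∃ f', Γ.IsStraightDrawing f' ∧ f' u = (0, 0) ∧ f' v = (2, 0) ∧
      ∀ a b, (a = b ∨ Γ.Adj a b) → s(a, b) ≠ s(u, v) → ∀ y ∈ segment ℝ (f' a) (f' b),
        0 ≤ y.2 → y.2 ≤ 2 * y.1 → y.2 ≤ 2 * (2 - y.1) → y = (0, 0) ∨ y = (2, 0) := by
  obtain ⟨g, hg, hgu, hgv⟩ : ∃ g, Γ.IsStraightDrawing g ∧ g u = (0, 0) ∧ g v = (2, 0) := by
    set p := (f v).1 - (f u).1 with hp
    set q := (f v).2 - (f u).2 with hq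
    have hpq : 0 < p ^ 2 + q ^ 2 := by
      by_contra hn
      have h1 : p = 0 := by nlinarith [sq_nonneg p, sq_nonneg q]
      have h2 : q = 0 := by nlinarith [sq_nonneg p, sq_nonneg q]
      refine huv.ne (hf.injective (Prod.ext ?_ ?_)) <;> linarith
    have hne := hpq.ne'
    -- The first row measures along the edge, scaled to length two, and the second perpendicularly
    -- to it.
    refine ⟨_, hf.comp (planeMap (2 * p / (p ^ 2 + q ^ 2)) (2 * q / (p ^ 2 + q ^ 2)) (-q) p (f u))
      (planeMap_injective ?_ _), ?_, ?_⟩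
    · have : 2 * p / (p ^ 2 + q ^ 2) * p - 2 * q / (p ^ 2 + q ^ 2) * -q = 2 := by
        field_simp
        ring
      rw [this]
      norm_num
    · simp [planeMap_apply]
    · simp only [Function.comp_apply, planeMap_apply, ← hp, ← hq, Prod.mk.injEq]
      constructor
      · field_simp
      · ring
  have hev : ∀ᶠ ε in 𝓝[>] (0 : ℝ), 0 < ε ∧ ∀ a b, (a = b ∨ Γ.Adj a b) → s(a, b) ≠ s(u, v) →
      ∀ y ∈ segment ℝ (g a) (g b), 0 ≤ y.2 → y.2 ≤ ε * y.1 →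
      y.2 ≤ ε * (2 - y.1) → y = (0, 0) ∨ y = (2, 0) := by
    refine eventually_mem_nhdsWithin.and ?_
    simp only [eventually_all (ι := W)]
    intro a b
    rw [eventually_all]
    intro hab
    rw [eventually_all]
    intro hne
    refine eventually_thin fun y hy hy' => ?_
    rw [← hgu, ← hgv] at hy' ⊢
    obtain ⟨w, h1, h2, rfl⟩ := (hg a b u v hab (Or.inr huv) y hy hy').resolve_left hne
    rcases h2 with rfl | rfl
    · exact Or.inl ⟨rfl, h1.imp (fun h => by rw [h]) (fun h => by rw [h])⟩
    · exact Or.inr ⟨rfl, h1.imp (fun h => by rw [h]) (fun h => by rw [h])⟩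
  obtain ⟨ε, hε, hfree⟩ := hev.exists
  -- A vertical stretch turns slope `ε` into slope `2`.
  refine ⟨_, hg.comp (planeMap 1 0 0 (2 / ε) 0) (planeMap_injective (by simp; exact hε.ne') _),
    by simp [planeMap_apply, hgu], by simp [planeMap_apply, hgv], ?_⟩
  intro a b hab hne y hy h0 h1 h2
  simp only [Function.comp_apply] at hy
  rw [← image_segment] at hy
  obtain ⟨z, hz, rfl⟩ := hy
  simp only [planeMap_apply, Prod.fst_zero, Prod.snd_zero, sub_zero, one_mul, zero_mul, add_zero,
    zero_add] at h0 h1 h2 ⊢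
  rw [div_mul_eq_mul_div, div_le_iff₀ hε] at h1 h2
  rcases hfree a b hab hne z hz (nonneg_of_mul_nonneg_right h0 (by positivity)) (by linarith)
    (by linarith) with rfl | rfl <;> simp

/-- A finite forest with an edge has a leaf. -/
lemma IsAcyclic.exists_leaf {V : Type*} [Finite V] {T : SimpleGraph V} (hT : T.IsAcyclic)
    (hne : T ≠ ⊥) : ∃ l x, T.Adj l x ∧ ∀ y, T.Adj l y → y = x := by
  obtain ⟨a, b, hab⟩ := ne_bot_iff_exists_adj.1 hne
  have : Nonempty V := ⟨a⟩
  -- The start of a longest path is a leaf: by maximality its neighbours lie on the path, and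
  -- acyclicity leaves only the second vertex.
  obtain ⟨u, v, p, hp, hmax⟩ := Walk.exists_isPath_forall_isPath_length_le_length T
  have hnil : ¬ p.Nil := by
    intro h
    have h1 := hmax a b (.cons hab .nil) (by simp [Walk.cons_isPath_iff, hab.ne])
    rw [Walk.length_eq_zero_iff.2 h] at h1
    simp at h1
  refine ⟨u, p.snd, p.adj_snd hnil, fun y hy => ?_⟩
  refine hT.eq_snd_of_adj_start hp hy ?_
  by_contra hn
  have h1 := hmax _ _ (.cons hy.symm p) (by rw [Walk.cons_isPath_iff]; exact ⟨hp, hn⟩)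
  simp at h1

end SimpleGraph

/-! ### Planarity and girth of doubled forests. -/

namespace SimpleGraph

variable {V : Type*}

/-- The strong product of `T` with an edge, that is `T.bowtie` together with the edges that join
the two copies of each vertex. -/
def double (T : SimpleGraph V) : SimpleGraph (V ⊕ V) where
  Adj p q := p ≠ q ∧ (Sum.elim id id p = Sum.elim id id q ∨
    T.Adj (Sum.elim id id p) (Sum.elim id id q))
  symm.symm _ _ := fun h => ⟨h.1.symm, h.2.imp Eq.symm fun h => h.symm⟩
  loopless.irrefl _ := fun h => h.1 rfl

lemma bowtie_le_double (T : SimpleGraph V) : T.bowtie ≤ T.double := by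
  intro p q h
  exact ⟨h.ne, Or.inr h⟩

/-- Without edges the double is a matching, drawn as vertical unit segments at distinct abscissas.
-/
lemma exists_isStraightDrawing_double_bot [Finite V] :
    ∃ f, (⊥ : SimpleGraph V).double.IsStraightDrawing f := by
  obtain ⟨n, ⟨idx⟩⟩ := Finite.exists_equiv_fin V
  let c : V → ℝ := fun v => ((idx v : ℕ) : ℝ)
  have hc : Function.Injective c := fun v w h => by
    have : (idx v : ℕ) = idx w := Nat.cast_injective (R := ℝ) h
    exact idx.injective (Fin.ext this)
  let f : V ⊕ V → ℝ × ℝ := Sum.elim (fun v => (c v, 0)) (fun v => (c v, 1))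
  have hf1 : ∀ p, (f p).1 = c (Sum.elim id id p) := by rintro (v | v) <;> rfl
  have hitem : ∀ p q, (p = q ∨ (⊥ : SimpleGraph V).double.Adj p q) →
      Sum.elim id id p = (Sum.elim id id q : V) := by
    rintro p q (rfl | ⟨-, h | h⟩)
    · rfl
    · exact h
    · exact absurd h (by simp)
  have hx1 : ∀ p q, (p = q ∨ (⊥ : SimpleGraph V).double.Adj p q) →
      ∀ x ∈ segment ℝ (f p) (f q), x.1 = c (Sum.elim id id p) := by
    rintro p q h x ⟨a, b, -, -, hab, rfl⟩
    simp only [Prod.fst_add, Prod.smul_fst, hf1, ← hitem p q h, smul_eq_mul]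
    rw [← add_mul, hab, one_mul]
  refine ⟨f, fun p q p' q' hpq hpq' x hx hx' => ?_⟩
  have h1 := hc ((hx1 p q hpq x hx).symm.trans (hx1 p' q' hpq' x hx'))
  have h2 := hitem p q hpq
  have h3 := hitem p' q' hpq'
  have hpair : ∀ a b c : V ⊕ V, Sum.elim id id a = (Sum.elim id id b : V) →
      Sum.elim id id a = (Sum.elim id id c : V) → b ≠ c → a = b ∨ a = c := by
    rintro (a | a) (b | b) (c | c) hb hc hbc <;>
      simp only [Sum.elim_inl, Sum.elim_inr, id] at hb hc <;> subst hb <;> subst hc <;>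
      simp at hbc ⊢
  have hfinj : Function.Injective f := by
    rintro (a | a) (b | b) h <;> simp only [f, Sum.elim_inl, Sum.elim_inr, Prod.mk.injEq] at h
    · rw [hc h.1]
    · exact absurd h.2 zero_ne_one
    · exact absurd h.2 one_ne_zero
    · rw [hc h.1]
  have hdeg : ∀ p x, x ∈ segment ℝ (f p) (f p) → x = f p := fun p x hx => by
    simpa [segment_same] using hx
  by_cases hp : p = q
  · subst hp
    obtain rfl := hdeg _ _ hx
    by_cases hp' : p' = q'
    · subst hp'
      left
      rw [hfinj (hdeg _ _ hx')]
    · exact Or.inr ⟨p, Or.inl rfl, hpair _ _ _ h1 (h1.trans h3) hp', rfl⟩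
  · by_cases hp' : p' = q'
    · subst hp'
      obtain rfl := hdeg _ _ hx'
      exact Or.inr ⟨p', hpair _ _ _ h1.symm (h1.symm.trans h2) hp, Or.inl rfl, rfl⟩
    · left
      rw [Sym2.eq_iff]
      rcases hpair p p' q' h1 (h1.trans h3) hp' with h | h <;>
        rcases hpair q p' q' (h2.symm.trans h1) ((h2.symm.trans h1).trans h3) hp' with h' | h'
      · exact absurd (h.trans h'.symm) hp
      · exact Or.inl ⟨h, h'⟩
      · exact Or.inr ⟨h, h'⟩
      · exact absurd (h.trans h'.symm) hp

/-- Adding a leaf: a straight-line drawing extends. -/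
lemma exists_isStraightDrawing_double_of_leaf [Finite V] {T : SimpleGraph V} {l x : V}
    (hlx : T.Adj l x) (hl : ∀ y, T.Adj l y → y = x)
    (h : ∃ f, (T.deleteIncidenceSet l).double.IsStraightDrawing f) :
    ∃ f, T.double.IsStraightDrawing f := by
  classical
  obtain ⟨f₀, hf₀⟩ := h
  set T' := T.deleteIncidenceSet l
  have hxl : x ≠ l := hlx.ne'
  have huv : T'.double.Adj (Sum.inl x) (Sum.inr x) := ⟨by simp, Or.inl rfl⟩
  obtain ⟨g, hg, hgu, hgv, hfree⟩ := hf₀.exists_free_triangle huv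
  -- Both copies of `l` move to the inner positions of `tetraPos` in the free triangle over the
  -- copies of `x`; their old positions are discarded.
  let f : V ⊕ V → ℝ × ℝ := fun p =>
    if p = Sum.inl l then (1, 2) else if p = Sum.inr l then (1, 1) else g p
  let β : Fin 4 → V ⊕ V := ![Sum.inl x, Sum.inr x, Sum.inl l, Sum.inr l]
  have hβ : Function.Injective β := by
    intro i j hij
    fin_cases i <;> fin_cases j <;> first | rfl | simp [β, hxl, hxl.symm] at hij
  have hfβ : ∀ i, f (β i) = tetraPos i := by
    intro i
    fin_cases i <;> simp [f, β, tetraPos, hxl, hgu, hgv]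
  have hfg : ∀ p : V ⊕ V, Sum.elim id id p ≠ l → f p = g p := by
    rintro (v | v) hv <;> simp only [Sum.elim_inl, Sum.elim_inr, id] at hv <;> simp [f, hv]
  have hrange : ∀ p : V ⊕ V, p ∈ Set.range β ↔ Sum.elim id id p = l ∨ Sum.elim id id p = x := by
    intro p
    constructor
    · rintro ⟨i, rfl⟩
      fin_cases i <;> simp [β]
    · rcases p with v | v <;> rintro (h | h) <;> simp only [Sum.elim_inl, Sum.elim_inr, id] at h <;>
        subst h
      · exact ⟨2, rfl⟩
      · exact ⟨0, rfl⟩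
      · exact ⟨3, rfl⟩
      · exact ⟨1, rfl⟩
  -- an edge is an old one or one of the complete graph on the range of `β`
  have hcases : ∀ p q, (p = q ∨ T.double.Adj p q) →
      (∃ i j, p = β i ∧ q = β j) ∨ ((p = q ∨ T'.double.Adj p q) ∧ f p = g p ∧ f q = g q ∧
        s(p, q) ≠ s(Sum.inl x, Sum.inr x)) := by
    intro p q hpq
    by_cases hb : p ∈ Set.range β ∧ q ∈ Set.range β
    · obtain ⟨⟨i, hi⟩, ⟨j, hj⟩⟩ := hb
      exact Or.inl ⟨i, j, hi.symm, hj.symm⟩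
    · right
      have hp : Sum.elim id id p ≠ l := by
        intro hp
        refine hb ⟨(hrange p).2 (Or.inl hp), (hrange q).2 ?_⟩
        rcases hpq with rfl | ⟨-, h | h⟩
        · exact Or.inl hp
        · exact Or.inl (h ▸ hp)
        · exact Or.inr (hl _ (hp ▸ h))
      have hq : Sum.elim id id q ≠ l := by
        intro hq
        refine hb ⟨(hrange p).2 ?_, (hrange q).2 (Or.inl hq)⟩
        rcases hpq with rfl | ⟨-, h | h⟩
        · exact Or.inl hq
        · exact Or.inl (h.trans hq)
        · exact Or.inr (hl _ (hq ▸ h.symm))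
      refine ⟨hpq.imp_right fun h => ⟨h.1, h.2.imp_right fun h =>
        deleteIncidenceSet_adj.2 ⟨h, hp, hq⟩⟩, hfg p hp, hfg q hq, fun h => hb ?_⟩
      rw [hrange, hrange]
      rcases Sym2.eq_iff.1 h with ⟨rfl, rfl⟩ | ⟨rfl, rfl⟩ <;> simp
  have htetra : ∀ i j k m y, y ∈ segment ℝ (tetraPos i) (tetraPos j) →
      y ∈ segment ℝ (tetraPos k) (tetraPos m) → s(i, j) = s(k, m) ∨
        ∃ w, (w = i ∨ w = j) ∧ (w = k ∨ w = m) ∧ y = tetraPos w := fun i j k m y =>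
    isStraightDrawing_tetraPos i j k m (by simp [em]) (by simp [em]) y
  -- The new segments lie in the free triangle, which old ones meet at most in the two copies of
  -- `x`.
  have hmix : ∀ i j p q, (p = q ∨ T'.double.Adj p q) → s(p, q) ≠ s(Sum.inl x, Sum.inr x) →
      ∀ y ∈ segment ℝ (tetraPos i) (tetraPos j), y ∈ segment ℝ (g p) (g q) →
      ∃ w, (w = β i ∨ w = β j) ∧ (w = p ∨ w = q) ∧ y = f w := by
    intro i j p q hpq hne y hy hy'
    have htri : 0 ≤ y.2 ∧ y.2 ≤ 2 * y.1 ∧ y.2 ≤ 2 * (2 - y.1) := by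
      obtain ⟨a, b, ha, hb, hab, rfl⟩ := hy
      obtain rfl : a = 1 - b := by linarith
      refine ⟨?_, ?_, ?_⟩ <;> fin_cases i <;> fin_cases j <;> simp [tetraPos] <;> linarith
    have haux : ∀ m, y = tetraPos m → f (β m) = g (β m) →
        ∃ w, (w = β i ∨ w = β j) ∧ (w = p ∨ w = q) ∧ y = f w := by
      intro m hm hm'
      refine ⟨β m, ?_, ?_, by rw [hfβ, hm]⟩
      · rw [hm] at hy
        exact (isStraightDrawing_tetraPos.eq_or_eq (by simp [em]) hy).imp (congrArg β)
          (congrArg β)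
      · rw [hm, ← hfβ, hm'] at hy'
        exact hg.eq_or_eq hpq hy'
    rcases hfree p q hpq hne y hy' htri.1 htri.2.1 htri.2.2 with h | h
    · exact haux 0 h (hfg _ hxl)
    · exact haux 1 h (hfg _ hxl)
  refine ⟨f, fun p q p' q' hpq hpq' y hy hy' => ?_⟩
  rcases hcases p q hpq with ⟨i, j, rfl, rfl⟩ | ⟨h1, h2, h3, h4⟩ <;>
    rcases hcases p' q' hpq' with ⟨k, m, rfl, rfl⟩ | ⟨h5, h6, h7, h8⟩
  · rw [hfβ, hfβ] at hy hy'
    refine (htetra i j k m y hy hy').imp (fun h => ?_) ?_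
    · exact congrArg (Sym2.map β) h
    · rintro ⟨w, h1, h2, rfl⟩
      exact ⟨β w, h1.imp (congrArg β) (congrArg β), h2.imp (congrArg β) (congrArg β), (hfβ w).symm⟩
  · rw [hfβ, hfβ] at hy
    rw [h6, h7] at hy'
    exact Or.inr (hmix i j p' q' h5 h8 y hy hy')
  · rw [hfβ, hfβ] at hy'
    rw [h2, h3] at hy
    obtain ⟨w, hw1, hw2, hw⟩ := hmix k m p q h1 h4 y hy' hy
    exact Or.inr ⟨w, hw2, hw1, hw⟩
  · rw [h2, h3] at hy
    rw [h6, h7] at hy'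
    refine (hg p q p' q' h1 h5 y hy hy').imp_right ?_
    rintro ⟨w, hw1, hw2, rfl⟩
    refine ⟨w, hw1, hw2, ?_⟩
    rcases hw1 with rfl | rfl
    · exact h2.symm
    · exact h3.symm

/-- Induction on the number of edges. `deleteIncidenceSet` keeps the leaf as an isolated vertex, so
the vertex type does not change. -/
theorem IsAcyclic.exists_isStraightDrawing_double [Finite V] {T : SimpleGraph V}
    (hT : T.IsAcyclic) : ∃ f, T.double.IsStraightDrawing f := by
  induction hn : T.edgeSet.ncard using Nat.strong_induction_on generalizing T with
  | _ n ih =>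
    by_cases hne : T = ⊥
    · rw [hne]
      exact exists_isStraightDrawing_double_bot
    · obtain ⟨l, x, hlx, hl⟩ := hT.exists_leaf hne
      refine exists_isStraightDrawing_double_of_leaf hlx hl
        (ih _ ?_ (hT.anti (deleteIncidenceSet_le T l)) rfl)
      rw [← hn]
      refine Set.ncard_lt_ncard ⟨edgeSet_mono (deleteIncidenceSet_le T l), fun h => ?_⟩
        T.edgeSet.toFinite
      have : (T.deleteIncidenceSet l).Adj l x := h (show s(l, x) ∈ T.edgeSet from hlx)
      rw [deleteIncidenceSet_adj] at this
      exact this.2.1 rfl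

/-- If `T` is a forest, then `T.bowtie` is planar. -/
theorem IsAcyclic.isPlanar_bowtie [Finite V] {T : SimpleGraph V} (hT : T.IsAcyclic) :
    T.bowtie.IsPlanar := by
  obtain ⟨f, hf⟩ := hT.exists_isStraightDrawing_double
  exact (hf.mono (bowtie_le_double T)).isPlanar

/-- If `T` is a forest, then `T.bowtie` has no triangles. -/
theorem IsAcyclic.four_le_egirth_bowtie {T : SimpleGraph V} (hT : T.IsAcyclic) :
    4 ≤ T.bowtie.egirth := by
  rw [le_egirth]
  intro a w hw
  have h3 := hw.three_le_length
  by_contra hlt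
  have hlt' : w.length < 4 := by
    rw [not_le] at hlt
    exact_mod_cast hlt
  have hlen : w.length = 3 := by omega
  have htri : ∃ x y z, T.Adj x y ∧ T.Adj y z ∧ T.Adj z x := by
    match w, hlen with
    | .cons h1 (.cons h2 (.cons h3 .nil)), _ => exact ⟨_, _, _, h1, h2, h3⟩
  obtain ⟨x, y, z, h1, h2, h3⟩ := htri
  have hg : 4 ≤ T.egirth := by
    rw [egirth_eq_top.2 hT]
    exact le_top
  exact not_adj_of_four_le_egirth hg x y z h1 h2 h3

/-! ### Decompositions, edge counts and the two bounds. -/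

lemma bowtie_iSup {ι : Type*} (T : ι → SimpleGraph V) : (⨆ i, T i).bowtie = ⨆ i, (T i).bowtie := by
  ext p q
  simp [bowtie]

lemma isUnionOfPlanarOfGirth_bowtie [Finite V] {G : SimpleGraph V} {k : ℕ}
    (h : G.IsUnionOfPlanarOfGirth ⊤ k) : G.bowtie.IsUnionOfPlanarOfGirth 4 k := by
  obtain ⟨T, hT, rfl⟩ := h
  have hac : ∀ i, (T i).IsAcyclic := fun i => egirth_eq_top.1 (top_le_iff.1 (hT i).2)
  exact ⟨fun i => (T i).bowtie, fun i => ⟨(hac i).isPlanar_bowtie, (hac i).four_le_egirth_bowtie⟩,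
    (bowtie_iSup T).symm⟩

/-- There are twice as many vertices, each of twice the degree. -/
lemma ncard_edgeSet_bowtie [Finite V] (G : SimpleGraph V) :
    G.bowtie.edgeSet.ncard = 4 * G.edgeSet.ncard := by
  classical
  have := Fintype.ofFinite V
  have h1 := G.sum_degrees_eq_twice_card_edges
  have h2 := G.bowtie.sum_degrees_eq_twice_card_edges
  have hdeg : ∀ p : V ⊕ V, G.bowtie.degree p = 2 * G.degree (Sum.elim id id p) := by
    intro p
    have : G.bowtie.neighborFinset p = (G.neighborFinset (Sum.elim id id p)).disjSum
        (G.neighborFinset (Sum.elim id id p)) := by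
      ext (v | v)
      · rw [mem_neighborFinset, Finset.inl_mem_disjSum, mem_neighborFinset]
        rfl
      · rw [mem_neighborFinset, Finset.inr_mem_disjSum, mem_neighborFinset]
        rfl
    rw [← card_neighborFinset_eq_degree, this, Finset.card_disjSum, card_neighborFinset_eq_degree]
    ring
  simp only [hdeg, Fintype.sum_sum_type, Sum.elim_inl, Sum.elim_inr, id, ← Finset.mul_sum] at h2
  replace h2 : 2 * (∑ v, G.degree v + ∑ v, G.degree v) = 2 * G.bowtie.edgeFinset.card := h2
  rw [← coe_edgeFinset, ← coe_edgeFinset, Set.ncard_coe_finset, Set.ncard_coe_finset]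
  omega

lemma IsUnionOfPlanarOfGirth.ncard_edgeSet_le [Finite V] {G : SimpleGraph V} {k : ℕ}
    (h : G.IsUnionOfPlanarOfGirth 4 k) (hV : 3 ≤ Nat.card V) :
    G.edgeSet.ncard ≤ k * (2 * Nat.card V - 4) := by
  obtain ⟨H, hH, rfl⟩ := h
  rw [edgeSet_iSup]
  calc (⋃ i, (H i).edgeSet).ncard ≤ ∑ i, (H i).edgeSet.ncard := by
        simpa using Set.ncard_iUnion_le_of_fintype fun i => (H i).edgeSet
    _ ≤ ∑ _i : Fin k, (2 * Nat.card V - 4) := Finset.sum_le_sum fun i _ => by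
        have := (hH i).1.ncard_edgeSet_add_four_le (hH i).2 hV
        omega
    _ = k * (2 * Nat.card V - 4) := by simp

end SimpleGraph

theorem corollary1 {V : Type*} [Finite V] (G : SimpleGraph V) (n e : ℕ)
    (hn : Nat.card V = n) (he : G.edgeSet.ncard = e) (hn2 : 2 ≤ n)
    (harb : SimpleGraph.girthThickness ⊤ G = (⌈(e : ℚ) / ((n : ℚ) - 1)⌉₊ : ℕ∞)) :
    SimpleGraph.girthThickness 4 G.bowtie = (⌈(e : ℚ) / ((n : ℚ) - 1)⌉₊ : ℕ∞) := by
  apply le_antisymm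
  · rw [← harb]
    exact le_iInf₂ fun k hk => iInf₂_le k (SimpleGraph.isUnionOfPlanarOfGirth_bowtie hk)
  · refine le_iInf₂ fun k hk => ?_
    have hcard : Nat.card (V ⊕ V) = 2 * n := by rw [Nat.card_sum, hn]; ring
    -- From `2 ≤ n` there are at least four vertices, so the planar edge bound applies to each part.
    have h1 := hk.ncard_edgeSet_le (by omega)
    rw [SimpleGraph.ncard_edgeSet_bowtie, he, hcard] at h1
    -- Writing `n = m + 1` removes truncated subtraction; the factor four of the edge count then
    -- cancels.
    obtain ⟨m, rfl⟩ : ∃ m, n = m + 1 := ⟨n - 1, by omega⟩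
    have h2 : 2 * (2 * (m + 1)) - 4 = 4 * m := by omega
    rw [h2] at h1
    have h3 : e ≤ k * m := by nlinarith
    refine Nat.cast_le.2 (Nat.ceil_le.2 ?_)
    have hm : (0 : ℚ) < m := by
      have : 0 < m := by omega
      exact_mod_cast this
    push_cast
    rw [add_sub_cancel_right, div_le_iff₀ hm]
    exact_mod_cast h3
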